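/- Let $L\ge 1$, $d\ge 1$, $\sigma_b\ge 0$, $\sigma_v>0$ and $\mathbf x\in\mathbb R^{d}$. For $a\ge 0$ and a Lévy measure $\rho$ on $(0,\infty)$ (a Borel measure with $\int_0^\infty\min(1,w)\,\rho(dw)<\infty$), let $\mathrm{ID}(a,\rho)$ be the law on $[0,\infty)$ with Laplace transform $t\mapsto\exp\bigl(-ta-\int_0^\infty(1-e^{-wt})\,\rho(dw)\bigr)$, $t\ge 0$, and let $\overline\rho(x)=\rho((x,\infty))$. Write $f(u)\sim g(u)$ for $\lim_{u\to\infty}f(u)/g(u)=1$, and call a measurable, eventually positive function $\ell$ slowly varying if $\ell(\gamma u)/\ell(u)\to 1$ as $u\to\infty$ for every $\gamma>0$. For $l=1,\dots,L$ let $a^{(l)}\ge 0$ and let $\rho^{(l)}$ be a Lévy measure on $(0,\infty)$ such that $\overline\rho^{(l)}(x)\sim c^{(l)}x^{-\tau^{(l)}}$ as $x\to\infty$, for some $c^{(l)}>0$ and $\tau^{(l)}>0$. Let $\phi(z)=\max(z,0)$ be the ReLU function, and let $S^{(1)},\dots,S^{(L)}$ be independent random variables with $S^{(l)}\sim\mathrm{ID}\bigl(a^{(l)}\,\mathbf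 E[\phi(\varepsilon)^2],\,\eta^{(l)}\bigr)$, where $\varepsilon\sim\mathcal N(0,1)$ and $\eta^{(l)}$ is the Lévy measure on $(0,\infty)$ with tail $$\overline\eta^{(l)}(x)=\int_{\{z:\phi(z)\ne 0\}}\overline\rho^{(l)}\bigl(x/\phi(z)^2\bigr)\frac{e^{-z^2/2}}{\sqrt{2\pi}}\,dz ,\qquad x>0.$$ Define $\Sigma^{(1)}(\mathbf x)=\sigma_b^2+\sigma_v^2\|\mathbf x\|^2/d$ and $\Sigma^{(l)}(\mathbf x)=\sigma_b^2+\sigma_v^2\,S^{(l-1)}\,\Sigma^{(l-1)}(\mathbf x)$ for $2\le l\le L+1$. (These are the limiting conditional variances of the pre-activations in an infinitely wide ReLU network with $L$ hidden layers whose per-node variances satisfy $\sum_{j\le p_l}\lambda^{(l)}_{p_l,j}\to\mathrm{ID}(a^{(l)},\rho^{(l)})$ in distribution.) For $k\ge 1$ and $2\le l\le L+1$ let $\zeta_k^{(l)}(\mathbf x)=\varepsilon_k^{(l)}\sqrt{\Sigma^{(l)}(\mathbf x)}$, where $\varepsilon_k^{(l)}\sim\mathcal N(0,1)$ is independent of $\Sigma^{(l)}(\mathbf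 x)$. 1. For every $l=1,\dots,L$, as $u\to\infty$, $$\Pr(S^{(l)}>u)\sim\tfrac12\,\overline\nu^{(l)}(u)\sim\widetilde c^{(l)}u^{-\tau^{(l)}},$$ where $$\overline\nu^{(l)}(u)=\int_0^\infty\overline\rho^{(l)}(u/z)\,\frac{e^{-z/2}}{\sqrt{2\pi z}}\,dz,\qquad \widetilde c^{(l)}=c^{(l)}\,\frac{2^{\tau^{(l)}-1}\,\Gamma(\tau^{(l)}+1/2)}{\sqrt\pi}.$$ 2. Assume that $\sigma_b>0$ or $\mathbf x\ne 0$. For $2\le l\le L+1$ put $\beta^{(l-1)}=\min(\tau^{(1)},\dots,\tau^{(l-1)})$. Then for every such $l$ there is a slowly varying function $L^{(l-1)}$ such that, as $u\to\infty$, $$\Pr\bigl(\Sigma^{(l)}(\mathbf x)>u\bigr)\sim u^{-\beta^{(l-1)}}L^{(l-1)}(u),$$ and, with the same function $L^{(l-1)}$, for all $k\ge 1$, $$\Pr\bigl((\zeta_k^{(l)}(\mathbf x))^2>u\bigr)\sim u^{-\beta^{(l-1)}}L^{(l-1)}(u)\;2^{\beta^{(l-1)}}\,\frac{\Gamma(\beta^{(l-1)}+1/2)}{\Gamma(1/2)}.$$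 -/

import Mathlib

open MeasureTheory ProbabilityTheory Filter Topology

/-- The relation `f(u) ~ g(u)` as `u → ∞`: the ratio `f(u) / g(u)` tends to `1`. -/
def AsympAtTop (f g : ℝ → ℝ) : Prop :=
  Tendsto (fun u => f u / g u) atTop (𝓝 1)

/-- `ℓ` is slowly varying at infinity. -/
structure IsSlowlyVarying (ℓ : ℝ → ℝ) : Prop where
  measurable : Measurable ℓ
  eventually_pos : ∀ᶠ x in atTop, 0 < ℓ x
  tendsto_ratio : ∀ γ : ℝ, 0 < γ → Tendsto (fun x => ℓ (γ * x) / ℓ x) atTop (𝓝 1)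

/-- `ρ` is a Lévy measure on `(0, ∞)`, viewed as a Borel measure on `ℝ` carried by `(0, ∞)`:
`∫ min(1, x) ρ(dx) < ∞`. -/
structure IsLevyMeasure (ρ : Measure ℝ) : Prop where
  nonpos_null : ρ (Set.Iic 0) = 0
  lintegral_min_lt_top : ∫⁻ x, ENNReal.ofReal (min 1 x) ∂ρ < ⊤

/-- The tail Lévy intensity `x ↦ ρ((x, ∞))`. -/
noncomputable def levyTail (ρ : Measure ℝ) (x : ℝ) : ℝ := ρ.real (Set.Ioi x)

/-- `μ` is the infinitely divisible law `ID(a, ρ)` on `[0, ∞)`: the probability law on `[0, ∞)`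
with Laplace transform `exp (-t a - ∫ (1 - exp (-w t)) ρ(dw))`, `t ≥ 0`. -/
structure IsInfDivLaw (μ : Measure ℝ) (a : ℝ) (ρ : Measure ℝ) : Prop where
  isProbabilityMeasure : IsProbabilityMeasure μ
  neg_null : μ (Set.Iio 0) = 0
  laplace : ∀ t : ℝ, 0 ≤ t →
    ∫ x, Real.exp (-(t * x)) ∂μ =
      Real.exp (-(t * a) - ∫ w, (1 - Real.exp (-(w * t))) ∂ρ)

/-- The ReLU activation function. -/
noncomputable def relu (z : ℝ) : ℝ := max z 0

/-- The location parameter `a ∫ φ(z)² N(0,1)(dz)` of the limit `S`. -/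
noncomputable def limitShift (φ : ℝ → ℝ) (a : ℝ) : ℝ :=
  a * ∫ z, φ z ^ 2 ∂(gaussianReal 0 1)

/-- The Lévy measure of the limit `S`: the image of `ρ(dw) ⊗ N(0,1)(dz)` under
`(w, z) ↦ w φ(z)²`, restricted to `(0, ∞)`. -/
noncomputable def limitLevyMeasure (φ : ℝ → ℝ) (ρ : Measure ℝ) : Measure ℝ :=
  ((ρ.prod (gaussianReal 0 1)).map (fun p : ℝ × ℝ => p.1 * φ p.2 ^ 2)).restrict (Set.Ioi 0)

theorem IsLevyMeasure.sFinite {ρ : Measure ℝ} (h : IsLevyMeasure ρ) : SFinite ρ := by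
  have hm : Measurable (fun x : ℝ => ENNReal.ofReal (min 1 x)) := by fun_prop
  have hpos : ∀ᵐ x ∂ρ, ENNReal.ofReal (min 1 x) ≠ 0 := by
    have : ∀ᵐ x ∂ρ, x ∉ Set.Iic (0 : ℝ) := measure_eq_zero_iff_ae_notMem.1 h.nonpos_null
    filter_upwards [this] with x hx
    have hx' : 0 < x := by simpa using hx
    simpa using hx'
  have hfin : IsFiniteMeasure (ρ.withDensity fun x => ENNReal.ofReal (min 1 x)) :=
    isFiniteMeasure_withDensity h.lintegral_min_lt_top.ne
  have he := withDensity_inv_same hm hpos (Filter.Eventually.of_forall fun x => by simp)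
  rw [← he]
  infer_instance

/-- The tail of the limiting Lévy measure is
`∫_{φ(z) ≠ 0} ρ((x / φ(z)², ∞)) φ_N(z) dz`, where `φ_N` is the standard normal density. -/
theorem limitLevyMeasure_Ioi {φ : ℝ → ℝ} (hφ : Measurable φ) {ρ : Measure ℝ}
    (hρ : IsLevyMeasure ρ) {x : ℝ} (hx : 0 < x) :
    limitLevyMeasure φ ρ (Set.Ioi x) =
      ∫⁻ z in {z | φ z ≠ 0}, gaussianPDF 0 1 z * ρ (Set.Ioi (x / φ z ^ 2)) := by
  have := hρ.sFinite
  have hmeas : Measurable (fun p : ℝ × ℝ => p.1 * φ p.2 ^ 2) := by fun_prop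
  have hs : MeasurableSet {z | φ z ≠ 0} := (hφ (measurableSet_singleton 0)).compl
  have hpre : MeasurableSet ((fun p : ℝ × ℝ => p.1 * φ p.2 ^ 2) ⁻¹' Set.Ioi x) :=
    hmeas measurableSet_Ioi
  rw [limitLevyMeasure, Measure.restrict_apply measurableSet_Ioi,
    Set.inter_eq_left.2 (Set.Ioi_subset_Ioi hx.le),
    Measure.map_apply hmeas measurableSet_Ioi, Measure.prod_apply_symm hpre,
    gaussianReal_of_var_ne_zero 0 one_ne_zero,
    lintegral_withDensity_eq_lintegral_mul _ (measurable_gaussianPDF 0 1)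
      (measurable_measure_prodMk_right hpre), ← lintegral_indicator hs]
  refine lintegral_congr fun z => ?_
  by_cases hz : φ z = 0
  · simp [hz, Set.preimage, not_lt.2 hx.le]
  · have hz2 : 0 < φ z ^ 2 := by positivity
    simp only [Pi.mul_apply, Set.indicator, Set.mem_ofPred_eq, ne_eq, hz, not_false_eq_true,
      if_true]
    congr 2
    ext w
    simp [div_lt_iff₀ hz2]

/-- `u ↦ ∫_0^∞ ρ((u/z, ∞)) Gamma(z; 1/2, 1/2) dz`, the tail Lévy intensity of the limiting sum of
squared (standardised) incoming weights. -/
noncomputable def nuTail (ρ : Measure ℝ) (u : ℝ) : ℝ :=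
  ∫ z in Set.Ioi (0 : ℝ), levyTail ρ (u / z) * gammaPDFReal (1 / 2) (1 / 2) z

/-- The limiting conditional variances `Σ^(l)(x)` (meaningful for `l ≥ 1`):
`Σ^(1)(x) = σb² + σv² ‖x‖² / d` and `Σ^(l)(x) = σb² + σv² S^(l-1) Σ^(l-1)(x)` for `l ≥ 2`. -/
noncomputable def limitVariance {Ω : Type*} {d : ℕ} (σb σv : ℝ) (x : EuclideanSpace ℝ (Fin d))
    (S : ℕ → Ω → ℝ) : ℕ → Ω → ℝ
  | 0, _ => 0
  | 1, _ => σb ^ 2 + σv ^ 2 * ‖x‖ ^ 2 / d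
  | l + 2, ω => σb ^ 2 + σv ^ 2 * S (l + 1) ω * limitVariance σb σv x S (l + 1) ω

/-- `min(τ^(1), …, τ^(m))` for `m ≥ 1`. -/
noncomputable def minExponent (τ : ℕ → ℝ) (m : ℕ) (hm : 1 ≤ m) : ℝ :=
  (Finset.Icc 1 m).inf' (Finset.nonempty_Icc.2 hm) τ

/-! The proof rests on three facts about heavy tails.

One big jump: an infinitely divisible law on `[0, ∞)` with a power-law Lévy tail has the same tail
as its Lévy measure (`IsInfDivLaw.tendsto_tail`). Differentiating the Laplace transform gives
Steutel's identity x μ(dx) = a μ(dx) + (μ ∗ w ρ(dw))(dx). Dividing by x writes μ((u, ∞)) as the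
integral of w / (s + w) over {s + w > u} against ρ(dw) μ(ds), plus a drift term of order a / u times
μ((u, ∞)). Either w alone is almost u, which yields the Lévy tail, or s > δu, and then the weight w
/ (s + w) is small on average. The resulting inequalities determine the tail
(`tendsto_of_renewal_bounds`). The Lévy tail of S and `nuTail` are both mixtures of the tail of ρ
over a squared Gaussian, so each multiplies c by a Gaussian moment; ReLU keeps only the positive
half-line, whence the factor 1/2.

Products: if X has a power tail of index α and Y is independent and regularly varying of index β,
then XY is regularly varying of index min(α, β) (`IsRegVar.survival_mul_min`). Induction on the
layer, with affine maps harmless, handles Σ^(l). Equal indices can produce logarithmic factors, so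
only regular variation survives the induction. The slowly varying function is u^β P(Σ > u) itself,
which makes the first asymptotic relation an equality for u > 0.

Breiman's lemma (`tendsto_survival_mul_div`): multiplying by an independent factor with more than α
moments multiplies the tail by its α-th moment. Applied to ζ² = Σ ε², it gives the constant
E|ε|^{2β}. -/

/-! ### Laplace transforms and Steutel's identity. -/

/-- Two finite measures on `ℝ` whose moment-generating functions are finite and coincide on
`(-∞, 1)` are equal. -/
theorem ext_of_mgf_eqOn_Iio_one {μ ν : Measure ℝ} [IsFiniteMeasure μ] [IsFiniteMeasure ν]
    (hμ : Set.Iio 1 ⊆ integrableExpSet id μ) (hν : Set.Iio 1 ⊆ integrableExpSet id ν)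
    (h : ∀ t < 1, mgf id μ t = mgf id ν t) : μ = ν := by
  have hμ' : Set.Iio 1 ⊆ interior (integrableExpSet id μ) := interior_maximal hμ isOpen_Iio
  have hν' : Set.Iio 1 ⊆ interior (integrableExpSet id ν) := interior_maximal hν isOpen_Iio
  have hA : AnalyticOnNhd ℂ (complexMGF id μ) {z | z.re ∈ Set.Iio (1 : ℝ)} :=
    analyticOnNhd_complexMGF.mono fun z hz => hμ' hz
  have hB : AnalyticOnNhd ℂ (complexMGF id ν) {z | z.re ∈ Set.Iio (1 : ℝ)} :=
    analyticOnNhd_complexMGF.mono fun z hz => hν' hz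
  have hconn : IsPreconnected {z : ℂ | z.re ∈ Set.Iio (1 : ℝ)} :=
    ((convex_Iio (1 : ℝ)).linear_preimage Complex.reLm).isPreconnected
  -- The identity theorem carries equality from real points near 0 to the half-plane Re z < 1, whose
  -- imaginary axis holds the characteristic functions.
  have hEq : Set.EqOn (complexMGF id μ) (complexMGF id ν) {z | z.re ∈ Set.Iio (1 : ℝ)} := by
    refine hA.eqOn_of_preconnected_of_frequently_eq hB hconn (z₀ := ((0 : ℝ) : ℂ)) (by simp) ?_
    have hev : ∀ᶠ x : ℝ in 𝓝[≠] 0, complexMGF id μ x = complexMGF id ν x := by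
      filter_upwards [mem_nhdsWithin_of_mem_nhds (Iio_mem_nhds (zero_lt_one' ℝ))] with y hy
      rw [complexMGF_ofReal, complexMGF_ofReal, h y hy]
    have hfr := hev.frequently
    rw [frequently_iff_seq_forall] at hfr ⊢
    obtain ⟨xs, hx_tendsto, hx_eq⟩ := hfr
    refine ⟨fun n ↦ xs n, ?_, fun n ↦ hx_eq n⟩
    rw [tendsto_nhdsWithin_iff] at hx_tendsto ⊢
    refine ⟨(Complex.continuous_ofReal.tendsto 0).comp hx_tendsto.1, ?_⟩
    simpa using hx_tendsto.2
  refine Measure.ext_of_charFun (funext fun t => ?_)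
  rw [← complexMGF_id_mul_I, ← complexMGF_id_mul_I]
  exact hEq (by simp)

theorem IsLevyMeasure.ae_pos {ρ : Measure ℝ} (h : IsLevyMeasure ρ) : ∀ᵐ w ∂ρ, 0 < w := by
  have : ∀ᵐ x ∂ρ, x ∉ Set.Iic (0 : ℝ) := measure_eq_zero_iff_ae_notMem.1 h.nonpos_null
  filter_upwards [this] with x hx
  simpa using hx

theorem IsLevyMeasure.integrable_min {ρ : Measure ℝ} (h : IsLevyMeasure ρ) :
    Integrable (fun w => min 1 w) ρ := by
  refine ⟨by fun_prop, ?_⟩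
  rw [hasFiniteIntegral_iff_ofReal]
  · exact h.lintegral_min_lt_top
  · filter_upwards [h.ae_pos] with w hw
    exact le_min zero_le_one hw.le

theorem IsLevyMeasure.integrable_of_le {ρ : Measure ℝ} (h : IsLevyMeasure ρ) {f : ℝ → ℝ}
    (hf : Measurable f) {C : ℝ} (hC : ∀ w, 0 < w → |f w| ≤ C * min 1 w) : Integrable f ρ := by
  refine (h.integrable_min.const_mul C).mono' hf.aestronglyMeasurable ?_
  filter_upwards [h.ae_pos] with w hw using hC w hw

theorem mul_exp_neg_le_min {s w : ℝ} (hs : 0 < s) (hw : 0 < w) :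
    w * Real.exp (-(s * w)) ≤ (1 + 1 / s) * min 1 w := by
  have h1 : Real.exp (-(s * w)) ≤ 1 := Real.exp_le_one_iff.2 (by nlinarith [mul_pos hs hw])
  have h0 := Real.exp_pos (-(s * w))
  have h2 : s * w * Real.exp (-(s * w)) ≤ 1 := by
    have := Real.add_one_le_exp (s * w)
    rw [Real.exp_neg, ← div_eq_mul_inv, div_le_one (Real.exp_pos _)]
    linarith
  have h3 : w * Real.exp (-(s * w)) ≤ 1 / s := by
    rw [le_div_iff₀ hs]; linarith
  have hs' : 0 < 1 / s := by positivity
  rcases le_total w 1 with h | h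
  · rw [min_eq_right h]; nlinarith
  · rw [min_eq_left h]; linarith

theorem one_sub_exp_neg_le_min {s w : ℝ} (hs : 0 < s) (hw : 0 < w) :
    |1 - Real.exp (-(w * s))| ≤ (1 + s) * min 1 w := by
  have h1 : Real.exp (-(w * s)) ≤ 1 := Real.exp_le_one_iff.2 (by nlinarith [mul_pos hs hw])
  have h0 := Real.exp_pos (-(w * s))
  have h2 := Real.add_one_le_exp (-(w * s))
  rw [abs_of_nonneg (by linarith)]
  rcases le_total w 1 with h | h
  · rw [min_eq_right h]; nlinarith
  · rw [min_eq_left h]; linarith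

/-- Derivative of the Laplace exponent. -/
theorem IsLevyMeasure.hasDerivAt_exponent {ρ : Measure ℝ} (h : IsLevyMeasure ρ) {s : ℝ}
    (hs : 0 < s) :
    HasDerivAt (fun t => ∫ w, (1 - Real.exp (-(w * t))) ∂ρ)
      (∫ w, w * Real.exp (-(s * w)) ∂ρ) s := by
  refine (hasDerivAt_integral_of_dominated_loc_of_deriv_le (μ := ρ)
    (F := fun t w => 1 - Real.exp (-(w * t))) (F' := fun t w => w * Real.exp (-(t * w)))
    (bound := fun w => (1 + 1 / (s / 2)) * min 1 w) (Ioi_mem_nhds (half_lt_self hs))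
    (Eventually.of_forall fun t => by fun_prop)
    (h.integrable_of_le (by fun_prop) fun w hw => one_sub_exp_neg_le_min hs hw)
    (by fun_prop) ?_ (h.integrable_min.const_mul _) ?_).2
  · filter_upwards [h.ae_pos] with w hw t ht
    have ht' : s / 2 < t := ht
    rw [Real.norm_of_nonneg (by positivity)]
    refine le_trans ?_ (mul_exp_neg_le_min (half_pos hs) hw)
    gcongr
  · refine Eventually.of_forall fun w t _ => ?_
    have h1 : HasDerivAt (fun y => -(w * y)) (-(w * 1)) t :=
      ((hasDerivAt_id' t).const_mul w).fun_neg
    exact (h1.exp.const_sub 1).congr_deriv (by ring_nf)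

theorem hasDerivAt_laplace {μ : Measure ℝ} [IsFiniteMeasure μ] (hμ : ∀ᵐ x ∂μ, 0 ≤ x) {s : ℝ}
    (hs : 0 < s) :
    HasDerivAt (fun t => ∫ x, Real.exp (-(t * x)) ∂μ)
      (∫ x, -(x * Real.exp (-(s * x))) ∂μ) s := by
  refine (hasDerivAt_integral_of_dominated_loc_of_deriv_le (μ := μ)
    (F := fun t x => Real.exp (-(t * x))) (F' := fun t x => -(x * Real.exp (-(t * x))))
    (bound := fun _ => (1 + 1 / (s / 2))) (Ioi_mem_nhds (half_lt_self hs))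
    (Eventually.of_forall fun t => by fun_prop) ?_ (by fun_prop) ?_ (integrable_const _) ?_).2
  · refine (integrable_const (1 : ℝ)).mono' (by fun_prop) ?_
    filter_upwards [hμ] with x hx
    rw [Real.norm_of_nonneg (Real.exp_pos _).le]
    exact Real.exp_le_one_iff.2 (by nlinarith [mul_nonneg hs.le hx])
  · filter_upwards [hμ] with w hw t ht
    have ht' : s / 2 < t := ht
    rw [norm_neg, Real.norm_of_nonneg (by positivity)]
    rcases hw.eq_or_lt with rfl | hw
    · simp; positivity
    · have h1 := mul_exp_neg_le_min (half_pos hs) hw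
      have h2 : w * Real.exp (-(t * w)) ≤ w * Real.exp (-(s / 2 * w)) := by gcongr
      have h3 : (1 + 1 / (s / 2)) * min 1 w ≤ (1 + 1 / (s / 2)) * 1 := by
        gcongr
        exact min_le_left _ _
      linarith
  · refine Eventually.of_forall fun w t _ => ?_
    have h1 : HasDerivAt (fun y => -(y * w)) (-(1 * w)) t :=
      ((hasDerivAt_id' t).mul_const w).fun_neg
    exact h1.exp.congr_deriv (by ring)

theorem IsInfDivLaw.ae_nonneg {μ : Measure ℝ} {a : ℝ} {ρ : Measure ℝ} (h : IsInfDivLaw μ a ρ) :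
    ∀ᵐ x ∂μ, 0 ≤ x := by
  have : ∀ᵐ x ∂μ, x ∉ Set.Iio (0 : ℝ) := measure_eq_zero_iff_ae_notMem.1 h.neg_null
  filter_upwards [this] with x hx
  simpa using hx

/-- Compares the derivatives of the two expressions for the Laplace transform; this is Steutel's
identity at the level of transforms. -/
theorem IsInfDivLaw.integral_mul_exp {μ : Measure ℝ} {a : ℝ} {ρ : Measure ℝ}
    (h : IsInfDivLaw μ a ρ) (hρ : IsLevyMeasure ρ) {s : ℝ} (hs : 0 < s) :
    ∫ x, x * Real.exp (-(s * x)) ∂μ =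
      (a + ∫ w, w * Real.exp (-(s * w)) ∂ρ) * ∫ x, Real.exp (-(s * x)) ∂μ := by
  have := h.isProbabilityMeasure
  have h1 := hasDerivAt_laplace h.ae_nonneg hs
  have h2 : HasDerivAt (fun t => ∫ x, Real.exp (-(t * x)) ∂μ) _ s :=
    ((((hasDerivAt_id s).mul_const a).neg.sub (hρ.hasDerivAt_exponent hs)).exp).congr_of_eventuallyEq
      (by
        filter_upwards [Ioi_mem_nhds hs] with t ht
        exact h.laplace t (le_of_lt ht))
  have h3 := h1.unique h2
  rw [integral_neg] at h3
  rw [h.laplace s hs.le]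
  simp only [Pi.neg_apply, Pi.sub_apply, id] at h3
  linarith

/-- The measure `x e^{-x} μ(dx)`. -/
noncomputable def expSizeBiased (μ : Measure ℝ) : Measure ℝ :=
  μ.withDensity fun x => ENNReal.ofReal (x * Real.exp (-x))

/-- The measure `e^{-x} μ(dx)`. -/
noncomputable def expTilted (μ : Measure ℝ) : Measure ℝ :=
  μ.withDensity fun x => ENNReal.ofReal (Real.exp (-x))

theorem integrable_mul_exp_neg {μ : Measure ℝ} [IsFiniteMeasure μ] (hμ : ∀ᵐ x ∂μ, 0 ≤ x) {s : ℝ}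
    (hs : 0 < s) : Integrable (fun x => x * Real.exp (-(s * x))) μ := by
  refine (integrable_const (1 + 1 / s)).mono' (by fun_prop) ?_
  filter_upwards [hμ] with x hx
  rw [Real.norm_of_nonneg (by positivity)]
  rcases hx.eq_or_lt with rfl | hx
  · simp; positivity
  · refine (mul_exp_neg_le_min hs hx).trans ?_
    have : (1 + 1 / s) * min 1 x ≤ (1 + 1 / s) * 1 := by
      gcongr
      exact min_le_left _ _
    linarith

theorem IsLevyMeasure.integrable_mul_exp_neg {ρ : Measure ℝ} (h : IsLevyMeasure ρ) {s : ℝ}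
    (hs : 0 < s) : Integrable (fun x => x * Real.exp (-(s * x))) ρ :=
  h.integrable_of_le (by fun_prop) fun w hw => by
    rw [abs_of_nonneg (by positivity)]
    exact mul_exp_neg_le_min hs hw

theorem integrable_exp_neg {μ : Measure ℝ} [IsFiniteMeasure μ] (hμ : ∀ᵐ x ∂μ, 0 ≤ x) {s : ℝ}
    (hs : 0 < s) : Integrable (fun x => Real.exp (-(s * x))) μ := by
  refine (integrable_const (1 : ℝ)).mono' (by fun_prop) ?_
  filter_upwards [hμ] with x hx
  rw [Real.norm_of_nonneg (Real.exp_pos _).le]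
  exact Real.exp_le_one_iff.2 (by nlinarith [mul_nonneg hs.le hx])

/-- The weight e^{-x} shifts the argument: exponent t here is Laplace parameter s = 1 - t, so s > 0
becomes t < 1. The weight is needed because w ρ(dw) may be infinite. -/
theorem integrable_exp_expSizeBiased_iff {μ : Measure ℝ} (hμ : ∀ᵐ x ∂μ, 0 ≤ x) (t : ℝ) :
    Integrable (fun x => Real.exp (t * x)) (expSizeBiased μ) ↔
      Integrable (fun x => x * Real.exp (-((1 - t) * x))) μ := by
  rw [expSizeBiased, integrable_withDensity_iff_integrable_smul' (by fun_prop) (by simp)]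
  refine integrable_congr ?_
  filter_upwards [hμ] with x hx
  rw [ENNReal.toReal_ofReal (by positivity), smul_eq_mul, mul_assoc, ← Real.exp_add]
  ring_nf

theorem integral_exp_expSizeBiased {μ : Measure ℝ} (hμ : ∀ᵐ x ∂μ, 0 ≤ x) (t : ℝ) :
    ∫ x, Real.exp (t * x) ∂(expSizeBiased μ) = ∫ x, x * Real.exp (-((1 - t) * x)) ∂μ := by
  rw [expSizeBiased, integral_withDensity_eq_integral_toReal_smul (by fun_prop) (by simp)]
  refine integral_congr_ae ?_
  filter_upwards [hμ] with x hx
  rw [ENNReal.toReal_ofReal (by positivity), smul_eq_mul, mul_assoc, ← Real.exp_add]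
  ring_nf

theorem integrable_exp_expTilted_iff {μ : Measure ℝ} (t : ℝ) :
    Integrable (fun x => Real.exp (t * x)) (expTilted μ) ↔
      Integrable (fun x => Real.exp (-((1 - t) * x))) μ := by
  rw [expTilted, integrable_withDensity_iff_integrable_smul' (by fun_prop) (by simp)]
  refine integrable_congr (Eventually.of_forall fun x => ?_)
  simp only
  rw [ENNReal.toReal_ofReal (by positivity), smul_eq_mul, ← Real.exp_add]
  ring_nf

theorem integral_exp_expTilted {μ : Measure ℝ} (t : ℝ) :
    ∫ x, Real.exp (t * x) ∂(expTilted μ) = ∫ x, Real.exp (-((1 - t) * x)) ∂μ := by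
  rw [expTilted, integral_withDensity_eq_integral_toReal_smul (by fun_prop) (by simp)]
  refine integral_congr_ae (Eventually.of_forall fun x => ?_)
  simp only
  rw [ENNReal.toReal_ofReal (by positivity), smul_eq_mul, ← Real.exp_add]
  ring_nf

theorem isFiniteMeasure_of_integrable_exp_zero {μ : Measure ℝ}
    (h : Integrable (fun x => Real.exp (0 * x)) μ) : IsFiniteMeasure μ := by
  simp only [zero_mul, Real.exp_zero] at h
  exact (integrable_const_iff_isFiniteMeasure one_ne_zero).1 h

/-- Steutel's identity `x μ(dx) = a μ(dx) + (μ ∗ w ρ(dw))(dx)` for an infinitely divisible law on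
`[0, ∞)`, weighted by `e^{-x}`. -/
theorem IsInfDivLaw.expSizeBiased_eq {μ : Measure ℝ} {a : ℝ} {ρ : Measure ℝ}
    (h : IsInfDivLaw μ a ρ) (hρ : IsLevyMeasure ρ) (ha : 0 ≤ a) :
    expSizeBiased μ = ENNReal.ofReal a • expTilted μ +
      ((expTilted μ).prod (expSizeBiased ρ)).map (fun p => p.1 + p.2) := by
  have := h.isProbabilityMeasure
  have hμ := h.ae_nonneg
  have hρ0 : ∀ᵐ w ∂ρ, 0 ≤ w := hρ.ae_pos.mono fun w hw => hw.le
  have i1 : ∀ t < 1, Integrable (fun x => Real.exp (t * x)) (expSizeBiased μ) := fun t ht =>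
    (integrable_exp_expSizeBiased_iff hμ t).2 (_root_.integrable_mul_exp_neg hμ (by linarith))
  have i2 : ∀ t < 1, Integrable (fun x => Real.exp (t * x)) (expSizeBiased ρ) := fun t ht =>
    (integrable_exp_expSizeBiased_iff hρ0 t).2 (hρ.integrable_mul_exp_neg (by linarith))
  have i3 : ∀ t < 1, Integrable (fun x => Real.exp (t * x)) (expTilted μ) := fun t ht =>
    (integrable_exp_expTilted_iff t).2 (integrable_exp_neg hμ (by linarith))
  have := isFiniteMeasure_of_integrable_exp_zero (i1 0 zero_lt_one)
  have := isFiniteMeasure_of_integrable_exp_zero (i2 0 zero_lt_one)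
  have := isFiniteMeasure_of_integrable_exp_zero (i3 0 zero_lt_one)
  have : IsFiniteMeasure (ENNReal.ofReal a • expTilted μ) := Measure.smul_finite _ (by simp)
  have i4 : ∀ t < 1, Integrable (fun x => Real.exp (t * x))
      (((expTilted μ).prod (expSizeBiased ρ)).map (fun p => p.1 + p.2)) := fun t ht => by
    rw [integrable_map_measure (by fun_prop) (by fun_prop)]
    refine ((i3 t ht).mul_prod (i2 t ht)).congr (Eventually.of_forall fun p => ?_)
    simp only [Function.comp]
    rw [← Real.exp_add]; ring_nf
  have i5 : ∀ t < 1, Integrable (fun x => Real.exp (t * x)) (ENNReal.ofReal a • expTilted μ) :=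
    fun t ht => (i3 t ht).smul_measure (by simp)
  refine ext_of_mgf_eqOn_Iio_one (fun t ht => i1 t ht)
    (fun t ht => (i5 t ht).add_measure (i4 t ht)) fun t ht => ?_
  simp only [mgf, id]
  rw [integral_add_measure (i5 t ht) (i4 t ht), integral_smul_measure,
    integral_map (by fun_prop) (by fun_prop), integral_exp_expSizeBiased hμ,
    h.integral_mul_exp hρ (by linarith : 0 < 1 - t)]
  have : ∀ p : ℝ × ℝ, Real.exp (t * (p.1 + p.2)) = Real.exp (t * p.1) * Real.exp (t * p.2) :=
    fun p => by rw [← Real.exp_add]; ring_nf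
  simp_rw [this]
  rw [integral_prod_mul (fun x => Real.exp (t * x)) (fun x => Real.exp (t * x)),
    integral_exp_expSizeBiased hρ0, integral_exp_expTilted, ENNReal.toReal_ofReal ha, smul_eq_mul]
  ring

theorem IsLevyMeasure.isFiniteMeasure_expSizeBiased {ρ : Measure ℝ} (hρ : IsLevyMeasure ρ) :
    IsFiniteMeasure (expSizeBiased ρ) :=
  isFiniteMeasure_of_integrable_exp_zero
    ((integrable_exp_expSizeBiased_iff (hρ.ae_pos.mono fun w hw => hw.le) 0).2
      (hρ.integrable_mul_exp_neg (by norm_num)))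

/-! ### From Steutel's identity to the tail of an infinitely divisible law. -/

/-- The tail of an infinitely divisible law on `[0, ∞)` in terms of its Lévy measure. -/
theorem IsInfDivLaw.measure_Ioi {μ : Measure ℝ} {a : ℝ} {ρ : Measure ℝ}
    (h : IsInfDivLaw μ a ρ) (hρ : IsLevyMeasure ρ) (ha : 0 ≤ a) {u : ℝ} (hu : 0 < u) :
    μ (Set.Ioi u) = ENNReal.ofReal a * ∫⁻ x in Set.Ioi u, ENNReal.ofReal (1 / x) ∂μ +
      ∫⁻ s, ∫⁻ w, (Set.Ioi u).indicator (fun x => ENNReal.ofReal (w / x)) (s + w) ∂ρ ∂μ := by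
  have := h.isProbabilityMeasure
  have := hρ.isFiniteMeasure_expSizeBiased
  have hid := h.expSizeBiased_eq hρ ha
  -- Integrating e^x / x over (u, ∞) undoes the weight x e^{-x} and recovers μ((u, ∞)).
  let f : ℝ → ENNReal := (Set.Ioi u).indicator fun x => ENNReal.ofReal (Real.exp x / x)
  have hf : Measurable f := Measurable.indicator (by fun_prop) measurableSet_Ioi
  have hfe : ∀ y x : ℝ, 0 ≤ y → ENNReal.ofReal y * f x =
      (Set.Ioi u).indicator (fun x => ENNReal.ofReal (y * Real.exp x / x)) x := fun y x hy => by
    by_cases hx : x ∈ Set.Ioi u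
    · simp only [f, Set.indicator_of_mem hx]
      rw [← ENNReal.ofReal_mul hy, mul_div_assoc]
    · simp [f, Set.indicator_of_notMem hx]
  have e1 : ∫⁻ x, f x ∂(expSizeBiased μ) = μ (Set.Ioi u) := by
    rw [expSizeBiased, lintegral_withDensity_eq_lintegral_mul _ (by fun_prop) hf,
      ← lintegral_indicator_one measurableSet_Ioi]
    refine lintegral_congr_ae ?_
    filter_upwards [h.ae_nonneg] with x hx
    rw [Pi.mul_apply, hfe _ _ (by positivity)]
    by_cases hxu : x ∈ Set.Ioi u
    · have : x ≠ 0 := (hu.trans hxu).ne'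
      rw [Set.indicator_of_mem hxu, Set.indicator_of_mem hxu, mul_assoc, ← Real.exp_add]
      simp [this]
    · rw [Set.indicator_of_notMem hxu, Set.indicator_of_notMem hxu]
  have e2 : ∫⁻ x, f x ∂(expTilted μ) = ∫⁻ x in Set.Ioi u, ENNReal.ofReal (1 / x) ∂μ := by
    rw [expTilted, lintegral_withDensity_eq_lintegral_mul _ (by fun_prop) hf,
      ← lintegral_indicator measurableSet_Ioi]
    refine lintegral_congr fun x => ?_
    rw [Pi.mul_apply, hfe _ _ (by positivity)]
    simp only [Set.indicator, ← Real.exp_add]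
    simp
  have hg : Measurable fun s => ∫⁻ w, f (s + w) ∂(expSizeBiased ρ) :=
    Measurable.lintegral_prod_right' (f := fun p : ℝ × ℝ => f (p.1 + p.2)) (by fun_prop)
  rw [← e1, hid, lintegral_add_measure, lintegral_smul_measure, e2, smul_eq_mul,
    lintegral_map hf (by fun_prop), lintegral_prod _ (by fun_prop)]
  congr 1
  simp only
  rw [expTilted, lintegral_withDensity_eq_lintegral_mul _ (by fun_prop) hg]
  refine lintegral_congr fun s => ?_
  rw [Pi.mul_apply, expSizeBiased, lintegral_withDensity_eq_lintegral_mul _ (by fun_prop)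
    (by fun_prop), ← lintegral_const_mul _ (by fun_prop)]
  refine lintegral_congr_ae ?_
  filter_upwards [hρ.ae_pos] with w hw
  rw [Pi.mul_apply, ← mul_assoc, ← ENNReal.ofReal_mul (by positivity), hfe _ _ (by positivity)]
  simp only [Set.indicator]
  congr 2
  rw [mul_comm (Real.exp (-s)), mul_assoc, mul_assoc, ← Real.exp_add, ← Real.exp_add]
  simp

/-- On s + w > u, either w > (1 - δ)u, where the weight w / (s + w) is at most 1, or s > δu, where
it is at most min(1, w / u). -/
theorem IsInfDivLaw.measure_Ioi_le {μ : Measure ℝ} {a : ℝ} {ρ : Measure ℝ}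
    (h : IsInfDivLaw μ a ρ) (hρ : IsLevyMeasure ρ) (ha : 0 ≤ a) {u δ : ℝ} (hu : 0 < u)
    (hδ1 : δ < 1) :
    μ (Set.Ioi u) ≤ ρ (Set.Ioi ((1 - δ) * u)) +
      (ENNReal.ofReal (a / u) + ∫⁻ w, ENNReal.ofReal (min 1 (w / u)) ∂ρ) * μ (Set.Ioi (δ * u)) := by
  have := h.isProbabilityMeasure
  rw [h.measure_Ioi hρ ha hu]
  have b1 : ENNReal.ofReal a * ∫⁻ x in Set.Ioi u, ENNReal.ofReal (1 / x) ∂μ ≤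
      ENNReal.ofReal (a / u) * μ (Set.Ioi (δ * u)) := by
    calc ENNReal.ofReal a * ∫⁻ x in Set.Ioi u, ENNReal.ofReal (1 / x) ∂μ
        ≤ ENNReal.ofReal a * ∫⁻ x in Set.Ioi u, ENNReal.ofReal (1 / u) ∂μ := by
          refine mul_le_mul' le_rfl (setLIntegral_mono measurable_const fun x hx => ?_)
          have hx' : u < x := hx
          exact ENNReal.ofReal_le_ofReal (one_div_le_one_div_of_le hu hx'.le)
      _ = ENNReal.ofReal (a / u) * μ (Set.Ioi u) := by
          rw [setLIntegral_const, ← mul_assoc, ← ENNReal.ofReal_mul ha, mul_one_div]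
      _ ≤ _ := by
          gcongr
          nlinarith
  have b2 : ∫⁻ s, ∫⁻ w, (Set.Ioi u).indicator (fun x => ENNReal.ofReal (w / x)) (s + w) ∂ρ ∂μ ≤
      ∫⁻ s, (ρ (Set.Ioi ((1 - δ) * u)) + (Set.Ioi (δ * u)).indicator
        (fun _ => ∫⁻ w, ENNReal.ofReal (min 1 (w / u)) ∂ρ) s) ∂μ := by
    refine lintegral_mono_ae ?_
    filter_upwards [h.ae_nonneg] with s hs
    rw [← lintegral_indicator_one measurableSet_Ioi]
    have : (Set.Ioi (δ * u)).indicator (fun _ => ∫⁻ w, ENNReal.ofReal (min 1 (w / u)) ∂ρ) s =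
        ∫⁻ w, (Set.Ioi (δ * u)).indicator (fun _ => ENNReal.ofReal (min 1 (w / u))) s ∂ρ := by
      by_cases hsu : s ∈ Set.Ioi (δ * u)
      · simp only [Set.indicator_of_mem hsu]
      · simp only [Set.indicator_of_notMem hsu, lintegral_zero]
    rw [this, ← lintegral_add_left (Measurable.indicator measurable_one measurableSet_Ioi)]
    refine lintegral_mono_ae ?_
    filter_upwards [hρ.ae_pos] with w hw
    by_cases hsw : s + w ∈ Set.Ioi u
    · have hsw' : u < s + w := hsw
      have hle1 : w / (s + w) ≤ 1 := by rw [div_le_one (by linarith)]; linarith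
      rw [Set.indicator_of_mem hsw]
      by_cases hwu : w ∈ Set.Ioi ((1 - δ) * u)
      · rw [Set.indicator_of_mem hwu]
        exact le_add_right (ENNReal.ofReal_le_one.2 hle1)
      · have hwu' : w ≤ (1 - δ) * u := by simpa using hwu
        have hsu : s ∈ Set.Ioi (δ * u) := by
          change δ * u < s
          nlinarith
        rw [Set.indicator_of_mem hsu]
        refine le_add_left (ENNReal.ofReal_le_ofReal (le_min hle1 ?_))
        gcongr
    · rw [Set.indicator_of_notMem hsw]
      exact zero_le
  refine (add_le_add b1 b2).trans ?_
  rw [lintegral_add_left measurable_const, lintegral_indicator_const measurableSet_Ioi,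
    lintegral_const, measure_univ, mul_one]
  apply le_of_eq
  ring

/-- Keeps only the jumps w > u, on which w / (s + w) ≥ u / (s + u). -/
theorem IsInfDivLaw.le_measure_Ioi {μ : Measure ℝ} {a : ℝ} {ρ : Measure ℝ}
    (h : IsInfDivLaw μ a ρ) (hρ : IsLevyMeasure ρ) (ha : 0 ≤ a) {u : ℝ} (hu : 0 < u) :
    ρ (Set.Ioi u) * ∫⁻ s, ENNReal.ofReal (u / (s + u)) ∂μ ≤ μ (Set.Ioi u) := by
  rw [h.measure_Ioi hρ ha hu, ← lintegral_const_mul _ (by fun_prop)]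
  refine le_add_left (lintegral_mono_ae ?_)
  filter_upwards [h.ae_nonneg] with s hs
  rw [mul_comm, ← lintegral_indicator_const measurableSet_Ioi]
  refine lintegral_mono_ae ?_
  filter_upwards [hρ.ae_pos] with w hw
  by_cases hwu : w ∈ Set.Ioi u
  · have hwu' : u < w := hwu
    have hsw : s + w ∈ Set.Ioi u := by
      change u < s + w
      linarith
    rw [Set.indicator_of_mem hwu, Set.indicator_of_mem hsw]
    refine ENNReal.ofReal_le_ofReal ?_
    rw [div_le_div_iff₀ (by linarith) (by linarith)]
    nlinarith
  · rw [Set.indicator_of_notMem hwu]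
    exact zero_le

theorem IsLevyMeasure.measure_Ioi_lt_top {ρ : Measure ℝ} (hρ : IsLevyMeasure ρ) {u : ℝ}
    (hu : 0 < u) : ρ (Set.Ioi u) < ⊤ := by
  have h1 := hρ.integrable_min.measure_gt_lt_top (ε := min 1 u / 2) (by positivity)
  refine (measure_mono fun w hw => ?_).trans_lt h1
  have hw' : u < w := hw
  have h2 : min 1 u ≤ min 1 w := min_le_min le_rfl hw'.le
  have h3 : 0 < min 1 u := by positivity
  change min 1 u / 2 < min 1 w
  linarith

theorem IsLevyMeasure.measure_Ioi_ne_top {ρ : Measure ℝ} (hρ : IsLevyMeasure ρ) {u : ℝ}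
    (hu : 0 < u) : ρ (Set.Ioi u) ≠ ⊤ := (hρ.measure_Ioi_lt_top hu).ne

theorem IsLevyMeasure.integrable_min_div {ρ : Measure ℝ} (hρ : IsLevyMeasure ρ) {u : ℝ}
    (hu : 0 < u) : Integrable (fun w => min 1 (w / u)) ρ :=
  hρ.integrable_of_le (by fun_prop) (C := 1 + 1 / u) fun w hw => by
    rw [abs_of_nonneg (by positivity)]
    have : 0 < 1 / u := by positivity
    rcases le_total w 1 with h | h
    · rw [min_eq_right h]
      refine (min_le_right _ _).trans ?_
      rw [div_eq_mul_one_div]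
      nlinarith
    · rw [min_eq_left h]
      refine (min_le_left _ _).trans ?_
      linarith

theorem IsLevyMeasure.tendsto_integral_min_div {ρ : Measure ℝ} (hρ : IsLevyMeasure ρ) :
    Tendsto (fun u => ∫ w, min 1 (w / u) ∂ρ) atTop (𝓝 0) := by
  have h0 : (0 : ℝ) = ∫ w, (0 : ℝ) ∂ρ := by simp
  rw [h0]
  refine tendsto_integral_filter_of_dominated_convergence (fun w => min 1 w)
    (Eventually.of_forall fun u => by fun_prop) ?_ hρ.integrable_min ?_
  · filter_upwards [eventually_ge_atTop 1] with u hu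
    filter_upwards [hρ.ae_pos] with w hw
    rw [Real.norm_of_nonneg (by positivity)]
    exact min_le_min le_rfl (div_le_self hw.le hu)
  · refine Eventually.of_forall fun w => ?_
    have h1 : Tendsto (fun u => w / u) atTop (𝓝 0) := tendsto_const_nhds.div_atTop tendsto_id
    simpa using (tendsto_const_nhds (x := (1 : ℝ))).min h1

theorem IsInfDivLaw.real_Ioi_le {μ : Measure ℝ} {a : ℝ} {ρ : Measure ℝ}
    (h : IsInfDivLaw μ a ρ) (hρ : IsLevyMeasure ρ) (ha : 0 ≤ a) {u δ : ℝ} (hu : 0 < u)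
    (hδ1 : δ < 1) :
    μ.real (Set.Ioi u) ≤ levyTail ρ ((1 - δ) * u) +
      (a / u + ∫ w, min 1 (w / u) ∂ρ) * μ.real (Set.Ioi (δ * u)) := by
  have := h.isProbabilityMeasure
  have h0 : ∀ᵐ w ∂ρ, 0 ≤ min 1 (w / u) := by
    filter_upwards [hρ.ae_pos] with w hw
    positivity
  have h1 := h.measure_Ioi_le hρ ha hu hδ1
  have hint : (0 : ℝ) ≤ ∫ w, min 1 (w / u) ∂ρ := integral_nonneg_of_ae h0
  have hpos : 0 < (1 - δ) * u := mul_pos (by linarith) hu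
  rw [← ofReal_integral_eq_lintegral_ofReal (hρ.integrable_min_div hu) h0,
    ← ENNReal.ofReal_add (by positivity) hint] at h1
  have h2 := ENNReal.toReal_mono (by
    refine ENNReal.add_ne_top.2 ⟨hρ.measure_Ioi_ne_top hpos, ENNReal.mul_ne_top (by simp) (by simp)⟩)
    h1
  rwa [ENNReal.toReal_add (hρ.measure_Ioi_ne_top hpos) (ENNReal.mul_ne_top (by simp) (by simp)),
    ENNReal.toReal_mul, ENNReal.toReal_ofReal (by positivity)] at h2

theorem IsInfDivLaw.le_real_Ioi {μ : Measure ℝ} {a : ℝ} {ρ : Measure ℝ}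
    (h : IsInfDivLaw μ a ρ) (hρ : IsLevyMeasure ρ) (ha : 0 ≤ a) {u : ℝ} (hu : 0 < u) :
    levyTail ρ u * ∫ s, u / (s + u) ∂μ ≤ μ.real (Set.Ioi u) := by
  have := h.isProbabilityMeasure
  have h0 : ∀ᵐ s ∂μ, 0 ≤ u / (s + u) := by
    filter_upwards [h.ae_nonneg] with s hs
    positivity
  have hi : Integrable (fun s => u / (s + u)) μ := by
    refine (integrable_const (1 : ℝ)).mono' (Measurable.aestronglyMeasurable (by fun_prop)) ?_
    filter_upwards [h.ae_nonneg] with s hs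
    rw [Real.norm_of_nonneg (by positivity), div_le_one (by positivity)]
    linarith
  have h1 := h.le_measure_Ioi hρ ha hu
  rw [← ofReal_integral_eq_lintegral_ofReal hi h0] at h1
  have h2 := ENNReal.toReal_mono (by simp) h1
  rwa [ENNReal.toReal_mul, ENNReal.toReal_ofReal (integral_nonneg_of_ae h0)] at h2

theorem tendsto_integral_div_add {μ : Measure ℝ} [IsProbabilityMeasure μ]
    (hμ : ∀ᵐ x ∂μ, 0 ≤ x) : Tendsto (fun u => ∫ s, u / (s + u) ∂μ) atTop (𝓝 1) := by
  have h0 : (1 : ℝ) = ∫ w, (1 : ℝ) ∂μ := by simp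
  rw [h0]
  refine tendsto_integral_filter_of_dominated_convergence (fun _ => 1)
    (Eventually.of_forall fun u => Measurable.aestronglyMeasurable (by fun_prop)) ?_ (integrable_const _) ?_
  · filter_upwards [eventually_gt_atTop 0] with u hu
    filter_upwards [hμ] with s hs
    rw [Real.norm_of_nonneg (by positivity), div_le_one (by positivity)]
    linarith
  · filter_upwards [hμ] with s hs
    have h1 : Tendsto (fun u => 1 - s / (s + u)) atTop (𝓝 (1 - 0)) :=
      tendsto_const_nhds.sub (tendsto_const_nhds.div_atTop (tendsto_atTop_add_const_left _ _ tendsto_id))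
    rw [sub_zero] at h1
    refine h1.congr' ?_
    filter_upwards [eventually_gt_atTop 0] with u hu
    have : s + u ≠ 0 := by positivity
    field_simp
    ring

/-- Repeated halving brings any u > 0 into (0, u₀]. This serves the renewal bound and both power
bounds for regularly varying functions. -/
theorem halving_induction {p : ℝ → Prop} {u₀ : ℝ} (hu₀ : 0 < u₀)
    (h0 : ∀ u, 0 < u → u ≤ u₀ → p u) (hs : ∀ u, u₀ < u → p (u / 2) → p u) :
    ∀ u, 0 < u → p u := by
  have key : ∀ n : ℕ, ∀ u, 0 < u → u ≤ 2 ^ n * u₀ → p u := by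
    intro n
    induction n with
    | zero => intro u hu hle; exact h0 u hu (by simpa using hle)
    | succ n ih =>
      intro u hu hle
      rcases le_or_gt u u₀ with h | h
      · exact h0 u hu h
      · refine hs u h (ih _ (by positivity) ?_)
        rw [pow_succ] at hle
        linarith
  intro u hu
  obtain ⟨n, hn⟩ := pow_unbounded_of_one_lt (u / u₀) one_lt_two
  refine key n u hu ?_
  rw [div_lt_iff₀ hu₀] at hn
  exact hn.le

theorem tendsto_comp_const_mul {f : ℝ → ℝ} {τ κ : ℝ}
    (hf : Tendsto (fun u => u ^ τ * f u) atTop (𝓝 κ)) {γ : ℝ} (hγ : 0 < γ) :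
    Tendsto (fun u => u ^ τ * f (γ * u)) atTop (𝓝 (γ ^ (-τ) * κ)) := by
  have h1 := (hf.comp (tendsto_id.const_mul_atTop hγ)).const_mul (γ ^ (-τ))
  refine h1.congr' ?_
  filter_upwards [eventually_gt_atTop 0] with u hu
  simp only [Function.comp, id]
  rw [Real.mul_rpow hγ.le hu.le, ← mul_assoc, ← mul_assoc, ← Real.rpow_add hγ]
  simp

/-- If `N` has a power-law tail and `p` satisfies the renewal-type bounds of the tail of an
infinitely divisible law, then `p` has the same power-law tail as `N`. -/
theorem tendsto_of_renewal_bounds {p N h r : ℝ → ℝ} {τ κ : ℝ} (hτ : 0 < τ)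
    (hp0 : ∀ u, 0 ≤ p u) (hp1 : ∀ u, p u ≤ 1)
    (hN : Tendsto (fun u => u ^ τ * N u) atTop (𝓝 κ))
    (hh : Tendsto h atTop (𝓝 0)) (hh0 : ∀ u, 0 < u → 0 ≤ h u) (hr : Tendsto r atTop (𝓝 1))
    (hle : ∀ u δ, 0 < u → 0 < δ → δ < 1 → p u ≤ N ((1 - δ) * u) + h u * p (δ * u))
    (hge : ∀ u, 0 < u → N u * r u ≤ p u) :
    Tendsto (fun u => u ^ τ * p u) atTop (𝓝 κ) := by
  obtain ⟨B, hB⟩ : ∃ B, ∀ u, 0 < u → u ^ τ * p u ≤ B := by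
    -- Taking δ = 1/2, the quantity u^τ p(u) is at most K plus half its value at u / 2 for large u;
    -- any B ≥ 2K is preserved by B ↦ K + B / 2, and u₀^τ covers small u.
    set K := ((1 - 1 / 2 : ℝ)) ^ (-τ) * κ + 1
    have e1 : ∀ᶠ u in atTop, u ^ τ * N ((1 - 1 / 2) * u) ≤ K :=
      (tendsto_comp_const_mul hN (by norm_num)).eventually_le_const (lt_add_one _)
    have e2 : ∀ᶠ u in atTop, h u * 2 ^ τ ≤ 1 / 2 := by
      have := hh.mul_const ((2 : ℝ) ^ τ)
      rw [zero_mul] at this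
      exact this.eventually_le_const (by norm_num)
    obtain ⟨u₀, hu₀⟩ := eventually_atTop.1 ((e1.and e2).and (eventually_gt_atTop 0))
    have hpos : 0 < u₀ := (hu₀ u₀ le_rfl).2
    refine ⟨max (2 * K) (u₀ ^ τ), halving_induction hpos (fun u hu hle => ?_) fun u hu ih => ?_⟩
    · refine le_trans ?_ (le_max_right _ _)
      calc u ^ τ * p u ≤ u ^ τ * 1 := by gcongr; exact hp1 u
        _ ≤ u₀ ^ τ := by rw [mul_one]; gcongr
    · obtain ⟨⟨h1, h2⟩, -⟩ := hu₀ u hu.le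
      have hu' : 0 < u := hpos.trans hu
      have h3 := hle u (1 / 2) hu' (by norm_num) (by norm_num)
      have h4 : u ^ τ = 2 ^ τ * (u / 2) ^ τ := by
        rw [← Real.mul_rpow (by norm_num) (by positivity)]; congr 1; ring
      have h5 : 0 ≤ u ^ τ := by positivity
      have h6 : (1 / 2 * u) = u / 2 := by ring
      set B := max (2 * K) (u₀ ^ τ)
      have hB0 : 0 ≤ B := le_trans (by positivity) (le_max_right _ _)
      have hKB : 2 * K ≤ B := le_max_left _ _
      calc u ^ τ * p u ≤ u ^ τ * (N ((1 - 1 / 2) * u) + h u * p (1 / 2 * u)) := by gcongr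
        _ = u ^ τ * N ((1 - 1 / 2) * u) + (h u * 2 ^ τ) * ((u / 2) ^ τ * p (u / 2)) := by
          rw [h6, mul_add]; congr 1; rw [h4]; ring
        _ ≤ K + 1 / 2 * B := by
          refine add_le_add h1 (mul_le_mul h2 ih ?_ (by norm_num))
          exact mul_nonneg (by positivity) (hp0 _)
        _ ≤ B := by linarith
  refine tendsto_order.2 ⟨fun c hc => ?_, fun c hc => ?_⟩
  · have h1 := hN.mul hr
    rw [mul_one] at h1
    filter_upwards [h1.eventually_const_lt hc, eventually_gt_atTop 0] with u h2 hu
    refine h2.trans_le ?_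
    rw [mul_assoc]
    exact mul_le_mul_of_nonneg_left (hge u hu) (by positivity)
  -- With u^τ p(u) bounded, the term containing h vanishes for each fixed δ, and the remaining loss
  -- (1 - δ)^(-τ) is as close to 1 as desired.
  · obtain ⟨δ, hδc, hδ, hδ1⟩ : ∃ δ : ℝ, (1 - δ) ^ (-τ) * κ < c ∧ 0 < δ ∧ δ < 1 := by
      have hcont : Tendsto (fun δ : ℝ => (1 - δ) ^ (-τ) * κ) (𝓝[>] 0) (𝓝 ((1 - 0) ^ (-τ) * κ)) := by
        refine Tendsto.mono_left ?_ nhdsWithin_le_nhds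
        have : ContinuousAt (fun δ : ℝ => (1 - δ) ^ (-τ) * κ) 0 := by
          refine ContinuousAt.mul (ContinuousAt.rpow_const (by fun_prop) (Or.inl (by simp)))
            continuousAt_const
        exact this
      have h1 := hcont.eventually_lt_const (u := c) (by simpa using hc)
      obtain ⟨δ, h2, h3⟩ := (h1.and (Ioo_mem_nhdsGT (zero_lt_one' ℝ))).exists
      exact ⟨δ, h2, h3.1, h3.2⟩
    have h1 := (tendsto_comp_const_mul hN (γ := 1 - δ) (by linarith)).add
      (hh.mul_const (δ ^ (-τ) * B))
    rw [zero_mul, add_zero] at h1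
    filter_upwards [h1.eventually_lt_const hδc, eventually_gt_atTop 0] with u h2 hu
    refine lt_of_le_of_lt ?_ h2
    have h4 : u ^ τ = δ ^ (-τ) * (δ * u) ^ τ := by
      rw [Real.mul_rpow hδ.le hu.le, ← mul_assoc, ← Real.rpow_add hδ]; simp
    calc u ^ τ * p u ≤ u ^ τ * (N ((1 - δ) * u) + h u * p (δ * u)) := by
          gcongr
          exact hle u δ hu hδ hδ1
      _ = u ^ τ * N ((1 - δ) * u) + h u * (δ ^ (-τ) * ((δ * u) ^ τ * p (δ * u))) := by
          rw [mul_add]; congr 1; rw [h4]; ring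
      _ ≤ _ := by
          have := hh0 u hu
          have := hB (δ * u) (by positivity)
          gcongr

/-- An infinitely divisible law on `[0, ∞)` whose Lévy measure has a power-law tail has the same
tail as its Lévy measure. -/
theorem IsInfDivLaw.tendsto_tail {μ : Measure ℝ} {a : ℝ} {ρ : Measure ℝ}
    (h : IsInfDivLaw μ a ρ) (hρ : IsLevyMeasure ρ) (ha : 0 ≤ a) {τ κ : ℝ} (hτ : 0 < τ)
    (hN : Tendsto (fun u => u ^ τ * levyTail ρ u) atTop (𝓝 κ)) :
    Tendsto (fun u => u ^ τ * μ.real (Set.Ioi u)) atTop (𝓝 κ) := by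
  have := h.isProbabilityMeasure
  refine tendsto_of_renewal_bounds (h := fun u => a / u + ∫ w, min 1 (w / u) ∂ρ) hτ
    (fun _ => measureReal_nonneg) (fun _ => measureReal_le_one) hN ?_ (fun u hu => ?_)
    (tendsto_integral_div_add h.ae_nonneg) (fun u δ hu _ hδ1 => h.real_Ioi_le hρ ha hu hδ1)
    (fun u hu => h.le_real_Ioi hρ ha hu)
  · simpa using (tendsto_const_nhds.div_atTop tendsto_id).add hρ.tendsto_integral_min_div
  · refine add_nonneg (by positivity) (integral_nonneg_of_ae ?_)
    filter_upwards [hρ.ae_pos] with w hw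
    simp only [Pi.zero_apply]
    positivity

/-! ### Gaussian and Gamma moments. -/

/-- The absolute moment `E|ε|^{2τ}` of a standard normal variable. -/
noncomputable def chiSqMoment (τ : ℝ) : ℝ :=
  2 ^ τ * (Real.Gamma (τ + 1 / 2) / Real.Gamma (1 / 2))

theorem chiSqMoment_pos {τ : ℝ} (hτ : 0 < τ) : 0 < chiSqMoment τ := by
  have := Real.Gamma_pos_of_pos (s := τ + 1 / 2) (by positivity)
  have := Real.Gamma_pos_of_pos (s := 1 / 2) (by positivity)
  unfold chiSqMoment
  positivity

theorem sq_rpow_mul_gaussianPDFReal (s : ℝ) {z : ℝ} (hz : 0 < z) :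
    (z ^ 2) ^ s * gaussianPDFReal 0 1 z =
      (√(2 * Real.pi))⁻¹ * (z ^ (2 * s) * Real.exp (-(1 / 2) * z ^ (2 : ℝ))) := by
  rw [gaussianPDFReal, ← Real.rpow_natCast z 2, ← Real.rpow_mul hz.le]
  simp only [NNReal.coe_one, mul_one, sub_zero, Nat.cast_ofNat, Real.rpow_ofNat]
  rw [show -z ^ 2 / 2 = -(1 / 2) * z ^ 2 by ring]
  ring

theorem rpow_mul_gammaPDFReal (s : ℝ) {z : ℝ} (hz : 0 < z) :
    z ^ s * gammaPDFReal (1 / 2) (1 / 2) z =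
      (√(2 * Real.pi))⁻¹ * (z ^ (s - 1 / 2) * Real.exp (-(1 / 2) * z ^ (1 : ℝ))) := by
  rw [gammaPDFReal, if_pos hz.le, Real.Gamma_one_half_eq, Real.rpow_one, ← Real.sqrt_eq_rpow,
    show s - 1 / 2 = s + (1 / 2 - 1) by ring, Real.rpow_add hz, Real.sqrt_mul (by norm_num),
    Real.sqrt_div (by norm_num), Real.sqrt_one, neg_mul]
  field_simp

theorem half_rpow_neg_mul {s : ℝ} :
    (√(2 * Real.pi))⁻¹ * (1 / 2 : ℝ) ^ (-(s + 1 / 2)) = 2 ^ s / √Real.pi := by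
  rw [one_div (2 : ℝ), Real.inv_rpow (by norm_num), Real.rpow_neg (by norm_num), inv_inv,
    Real.rpow_add (by norm_num), Real.sqrt_mul (by norm_num), Real.sqrt_eq_rpow 2, one_div (2 : ℝ)]
  have : (2 : ℝ) ^ (2 : ℝ)⁻¹ ≠ 0 := by positivity
  field_simp

theorem integral_sq_rpow_mul_gaussianPDFReal {s : ℝ} (hs : 0 < s) :
    ∫ z in Set.Ioi (0 : ℝ), (z ^ 2) ^ s * gaussianPDFReal 0 1 z = chiSqMoment s / 2 := by
  rw [setIntegral_congr_fun measurableSet_Ioi fun z hz => sq_rpow_mul_gaussianPDFReal s hz,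
    integral_const_mul, integral_rpow_mul_exp_neg_mul_rpow (by norm_num) (by linarith)
      (by norm_num), chiSqMoment, Real.Gamma_one_half_eq,
    show -(2 * s + 1) / 2 = -(s + 1 / 2) by ring, show (2 * s + 1) / 2 = s + 1 / 2 by ring,
    ← mul_assoc, ← mul_assoc, half_rpow_neg_mul]
  ring

/-- Gamma(1/2, 1/2) is the law of ε², so this moment is twice the half-line Gaussian one. -/
theorem integral_rpow_mul_gammaPDFReal {s : ℝ} (hs : 0 < s) :
    ∫ z in Set.Ioi (0 : ℝ), z ^ s * gammaPDFReal (1 / 2) (1 / 2) z = chiSqMoment s := by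
  rw [setIntegral_congr_fun measurableSet_Ioi fun z hz => rpow_mul_gammaPDFReal s hz,
    integral_const_mul, integral_rpow_mul_exp_neg_mul_rpow (by norm_num) (by linarith)
      (by norm_num), chiSqMoment, Real.Gamma_one_half_eq,
    show -(s - 1 / 2 + 1) / 1 = -(s + 1 / 2) by ring, show (s - 1 / 2 + 1) / 1 = s + 1 / 2 by ring,
    ← mul_assoc, ← mul_assoc, half_rpow_neg_mul]
  ring

theorem integrableOn_sq_rpow_mul_gaussianPDFReal {s : ℝ} (hs : 0 < s) :
    IntegrableOn (fun z => (z ^ 2) ^ s * gaussianPDFReal 0 1 z) (Set.Ioi 0) :=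
  IntegrableOn.congr_fun ((integrableOn_rpow_mul_exp_neg_mul_rpow (p := 2) (s := 2 * s)
    (b := 1 / 2) (by linarith) (by norm_num) (by norm_num)).const_mul _)
    (fun _ hz => (sq_rpow_mul_gaussianPDFReal s hz).symm) measurableSet_Ioi

theorem integrableOn_rpow_mul_gammaPDFReal {s : ℝ} (hs : 0 < s) :
    IntegrableOn (fun z => z ^ s * gammaPDFReal (1 / 2) (1 / 2) z) (Set.Ioi 0) :=
  IntegrableOn.congr_fun ((integrableOn_rpow_mul_exp_neg_mul_rpow (p := 1) (s := s - 1 / 2)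
    (b := 1 / 2) (by linarith) (by norm_num) (by norm_num)).const_mul _)
    (fun _ hz => (rpow_mul_gammaPDFReal s hz).symm) measurableSet_Ioi

theorem integral_sq_rpow_gaussianReal {s : ℝ} (hs : 0 < s) :
    ∫ z, (z ^ 2) ^ s ∂(gaussianReal 0 1) = chiSqMoment s := by
  have h : ∀ z, gaussianPDFReal 0 1 z • (z ^ 2) ^ s =
      (fun y => (y ^ 2) ^ s * gaussianPDFReal 0 1 y) |z| := fun z => by
    simp [gaussianPDFReal, mul_comm]
  rw [integral_gaussianReal_eq_integral_smul one_ne_zero, integral_congr_ae (ae_of_all _ h),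
    integral_comp_abs (f := fun y => (y ^ 2) ^ s * gaussianPDFReal 0 1 y),
    integral_sq_rpow_mul_gaussianPDFReal hs]
  ring

theorem integrable_sq_rpow_gaussianReal {s : ℝ} (hs : 0 < s) :
    Integrable (fun z => (z ^ 2) ^ s) (gaussianReal 0 1) := by
  have : 0 < ∫ z, (z ^ 2) ^ s ∂(gaussianReal 0 1) := by
    rw [integral_sq_rpow_gaussianReal hs]
    exact chiSqMoment_pos hs
  -- The Bochner integral of a non-integrable function is 0, so a nonzero value proves
  -- integrability.
  exact Integrable.of_integral_ne_zero this.ne'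

/-! ### Lévy tails mixed over a squared Gaussian. -/

theorem levyTail_nonneg (ρ : Measure ℝ) (x : ℝ) : 0 ≤ levyTail ρ x := measureReal_nonneg

theorem measurable_levyTail (ρ : Measure ℝ) : Measurable (levyTail ρ) := by
  have h : Antitone fun x => ρ (Set.Ioi x) := fun x y hxy =>
    measure_mono (Set.Ioi_subset_Ioi hxy)
  exact h.measurable.ennreal_toReal

theorem IsLevyMeasure.levyTail_le {ρ : Measure ℝ} (hρ : IsLevyMeasure ρ) {x : ℝ} (hx : 0 < x) :
    levyTail ρ x ≤ (∫ w, min 1 w ∂ρ) * (1 + 1 / x) := by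
  have h0 : ∀ᵐ w ∂ρ, 0 ≤ min 1 w := by
    filter_upwards [hρ.ae_pos] with w hw
    positivity
  have hm : 0 < min 1 x := by positivity
  have h1 : min 1 x * ρ.real {w | min 1 x ≤ min 1 w} ≤ ∫ w, min 1 w ∂ρ :=
    mul_meas_ge_le_integral_of_nonneg h0 hρ.integrable_min _
  have h2 : levyTail ρ x ≤ ρ.real {w | min 1 x ≤ min 1 w} := by
    refine measureReal_mono (fun w (hw : x < w) => ?_) ?_
    · exact min_le_min (le_refl (1 : ℝ)) hw.le
    · exact (hρ.integrable_min.measure_ge_lt_top hm).ne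
  have h3 : levyTail ρ x ≤ (∫ w, min 1 w ∂ρ) / min 1 x := by
    rw [le_div_iff₀ hm, mul_comm]
    exact (mul_le_mul_of_nonneg_left h2 hm.le).trans h1
  refine h3.trans ?_
  rw [div_eq_mul_one_div]
  refine mul_le_mul_of_nonneg_left ?_ (integral_nonneg_of_ae h0)
  have : 0 < 1 / x := by positivity
  rcases le_total 1 x with h | h
  · rw [min_eq_left h]; linarith
  · rw [min_eq_right h]; linarith

theorem AsympAtTop.tendsto_rpow_mul {f : ℝ → ℝ} {c τ : ℝ} (hc : c ≠ 0)
    (h : AsympAtTop f fun x => c * x ^ (-τ)) : Tendsto (fun x => x ^ τ * f x) atTop (𝓝 c) := by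
  have h1 := Tendsto.const_mul c h
  rw [mul_one] at h1
  refine h1.congr' ?_
  filter_upwards [eventually_gt_atTop 0] with x hx
  rw [Real.rpow_neg hx.le]
  have : x ^ τ ≠ 0 := by positivity
  field_simp

/-- The power law governs large x; near 0 Markov's inequality for min(1, w) allows growth at most
like 1 / x. In mixtures that 1 / x costs one extra moment of the mixing variable. -/
theorem IsLevyMeasure.exists_rpow_mul_levyTail_le {ρ : Measure ℝ} (hρ : IsLevyMeasure ρ) {c τ : ℝ}
    (hτ : 0 < τ) (hN : Tendsto (fun x => x ^ τ * levyTail ρ x) atTop (𝓝 c)) :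
    ∃ K, 0 ≤ K ∧ ∀ x, 0 < x → x ^ τ * levyTail ρ x ≤ K * (1 + 1 / x) := by
  obtain ⟨x₀, hx₀⟩ := eventually_atTop.1
    ((hN.eventually_le_const (lt_add_one c)).and (eventually_gt_atTop 0))
  have hpos : 0 < x₀ := (hx₀ x₀ le_rfl).2
  have h0 : 0 ≤ c + 1 := le_trans (by have := levyTail_nonneg ρ x₀; positivity) (hx₀ x₀ le_rfl).1
  have hI : 0 ≤ ∫ w, min 1 w ∂ρ := by
    refine integral_nonneg_of_ae ?_
    filter_upwards [hρ.ae_pos] with w hw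
    simp only [Pi.zero_apply]
    positivity
  have hJ : 0 ≤ x₀ ^ τ * ∫ w, min 1 w ∂ρ := by positivity
  refine ⟨c + 1 + x₀ ^ τ * ∫ w, min 1 w ∂ρ, by positivity, fun x hx => ?_⟩
  have hx1 : 0 < 1 / x := by positivity
  rcases le_total x₀ x with h | h
  · have := (hx₀ x h).1
    nlinarith [mul_nonneg hJ hx1.le, mul_nonneg h0 hx1.le]
  · calc x ^ τ * levyTail ρ x ≤ x₀ ^ τ * ((∫ w, min 1 w ∂ρ) * (1 + 1 / x)) := by
          have := hρ.levyTail_le hx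
          have := levyTail_nonneg ρ x
          gcongr
      _ ≤ _ := by nlinarith [mul_nonneg h0 hx1.le]

/-- Mixtures of the tail of a Lévy measure with a power-law tail. -/
theorem IsLevyMeasure.tendsto_rpow_mul_integral {α : Type*} [MeasurableSpace α] {ν : Measure α}
    {ρ : Measure ℝ} (hρ : IsLevyMeasure ρ) {c τ : ℝ} (hτ : 0 < τ)
    (hN : Tendsto (fun x => x ^ τ * levyTail ρ x) atTop (𝓝 c)) {Y k : α → ℝ}
    (hY : Measurable Y) (hk : Measurable k) (hY0 : ∀ᵐ a ∂ν, 0 < Y a) (hk0 : ∀ a, 0 ≤ k a)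
    (hi : Integrable (fun a => Y a ^ τ * k a) ν)
    (hi' : Integrable (fun a => Y a ^ (τ + 1) * k a) ν) :
    Tendsto (fun u => u ^ τ * ∫ a, levyTail ρ (u / Y a) * k a ∂ν) atTop
      (𝓝 (c * ∫ a, Y a ^ τ * k a ∂ν)) := by
  obtain ⟨K, hK0, hK⟩ := hρ.exists_rpow_mul_levyTail_le hτ hN
  have hm := measurable_levyTail ρ
  simp_rw [← integral_const_mul]
  -- For u ≥ 1 the bound at x = u / Y has 1 / x = Y / u ≤ Y, giving the majorant K Y^τ (1 + Y) k.
  refine tendsto_integral_filter_of_dominated_convergence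
    (fun a => K * (Y a ^ τ * k a + Y a ^ (τ + 1) * k a)) ?_ ?_ ((hi.add hi').const_mul K) ?_
  · exact Eventually.of_forall fun u => Measurable.aestronglyMeasurable (by fun_prop)
  · filter_upwards [eventually_ge_atTop 1] with u hu
    filter_upwards [hY0] with a ha
    have hu0 : 0 < u := by linarith
    have h1 := hK (u / Y a) (by positivity)
    have h2 := levyTail_nonneg ρ (u / Y a)
    have h3 := hk0 a
    rw [Real.norm_of_nonneg (by positivity)]
    rw [Real.div_rpow hu0.le ha.le, one_div_div] at h1
    have hYp : 0 < Y a ^ τ := by positivity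
    have h4 : u ^ τ * levyTail ρ (u / Y a) ≤ Y a ^ τ * (K * (1 + Y a)) := by
      have h5 : Y a / u ≤ Y a := div_le_self ha.le hu
      calc u ^ τ * levyTail ρ (u / Y a) = Y a ^ τ * (u ^ τ / Y a ^ τ * levyTail ρ (u / Y a)) := by
            field_simp
        _ ≤ Y a ^ τ * (K * (1 + Y a / u)) := by gcongr
        _ ≤ _ := by gcongr
    calc u ^ τ * (levyTail ρ (u / Y a) * k a) = u ^ τ * levyTail ρ (u / Y a) * k a := by ring
      _ ≤ Y a ^ τ * (K * (1 + Y a)) * k a := by gcongr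
      _ = _ := by rw [Real.rpow_add_one ha.ne']; ring
  · filter_upwards [hY0] with a ha
    have h1 := hN.comp (tendsto_id.atTop_div_const ha)
    have h2 := h1.mul_const (Y a ^ τ * k a)
    refine h2.congr' ?_
    filter_upwards [eventually_gt_atTop 0] with u hu
    simp only [Function.comp, id]
    rw [Real.div_rpow hu.le ha.le]
    have hYp : 0 < Y a ^ τ := by positivity
    field_simp

theorem IsLevyMeasure.tendsto_nuTail {ρ : Measure ℝ} (hρ : IsLevyMeasure ρ) {c τ : ℝ} (hτ : 0 < τ)
    (hN : Tendsto (fun x => x ^ τ * levyTail ρ x) atTop (𝓝 c)) :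
    Tendsto (fun u => u ^ τ * nuTail ρ u) atTop (𝓝 (c * chiSqMoment τ)) := by
  rw [← integral_rpow_mul_gammaPDFReal hτ]
  refine hρ.tendsto_rpow_mul_integral (Y := fun z => z) hτ hN measurable_id
    (measurable_gammaPDFReal _ _) ?_ (fun z => ?_) (integrableOn_rpow_mul_gammaPDFReal hτ)
    (integrableOn_rpow_mul_gammaPDFReal (by linarith))
  · filter_upwards [ae_restrict_mem measurableSet_Ioi] with z hz using hz
  · exact gammaPDFReal_nonneg (by norm_num) (by norm_num) z

theorem measurable_relu : Measurable relu := by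
  unfold relu
  fun_prop

theorem levyTail_limitLevyMeasure_relu {ρ : Measure ℝ} (hρ : IsLevyMeasure ρ) {u : ℝ}
    (hu : 0 < u) : levyTail (limitLevyMeasure relu ρ) u =
      ∫ z in Set.Ioi (0 : ℝ), levyTail ρ (u / z ^ 2) * gaussianPDFReal 0 1 z := by
  have hset : {z | relu z ≠ 0} = Set.Ioi 0 := by
    ext z
    simp [relu]
  rw [levyTail, measureReal_def, limitLevyMeasure_Ioi measurable_relu hρ hu, hset,
    integral_eq_lintegral_of_nonneg_ae]
  · congr 1
    refine setLIntegral_congr_fun measurableSet_Ioi fun z hz => ?_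
    have hz' : 0 < z := hz
    rw [ENNReal.ofReal_mul (levyTail_nonneg _ _), mul_comm, levyTail,
      ofReal_measureReal (hρ.measure_Ioi_ne_top (by positivity)), relu, max_eq_left hz'.le]
    rfl
  · exact ae_of_all _ fun z => mul_nonneg (levyTail_nonneg _ _) (gaussianPDFReal_nonneg _ _ _)
  · have hm := measurable_levyTail ρ
    exact Measurable.aestronglyMeasurable (by fun_prop)

theorem IsLevyMeasure.tendsto_limitLevyMeasure {ρ : Measure ℝ} (hρ : IsLevyMeasure ρ) {c τ : ℝ}
    (hτ : 0 < τ) (hN : Tendsto (fun x => x ^ τ * levyTail ρ x) atTop (𝓝 c)) :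
    Tendsto (fun u => u ^ τ * levyTail (limitLevyMeasure relu ρ) u) atTop
      (𝓝 (c * (chiSqMoment τ / 2))) := by
  rw [← integral_sq_rpow_mul_gaussianPDFReal hτ]
  refine (hρ.tendsto_rpow_mul_integral (ν := volume.restrict (Set.Ioi 0)) (Y := fun z => z ^ 2) hτ
    hN (by fun_prop) (measurable_gaussianPDFReal 0 1) ?_ (gaussianPDFReal_nonneg _ _)
    (integrableOn_sq_rpow_mul_gaussianPDFReal hτ)
    (integrableOn_sq_rpow_mul_gaussianPDFReal (by linarith))).congr' ?_
  · filter_upwards [ae_restrict_mem measurableSet_Ioi] with z hz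
    exact pow_pos hz 2
  · filter_upwards [eventually_gt_atTop 0] with u hu
    rw [levyTail_limitLevyMeasure_relu hρ hu]

/-- Since φ(z)² ≤ z², min(1, w φ(z)²) ≤ min(1, w)(1 + z²), and the Gaussian second moment is finite.
-/
theorem IsLevyMeasure.limitLevyMeasure {ρ : Measure ℝ} (hρ : IsLevyMeasure ρ) :
    IsLevyMeasure (limitLevyMeasure relu ρ) := by
  have := hρ.sFinite
  have hr := measurable_relu
  refine ⟨by simp [_root_.limitLevyMeasure, Measure.restrict_apply measurableSet_Iic,
    Set.Iic_inter_Ioi], ?_⟩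
  have hfin : ∫⁻ z, ENNReal.ofReal (1 + z ^ 2) ∂(gaussianReal 0 1) < ⊤ := by
    have h1 : Integrable (fun z : ℝ => 1 + z ^ 2) (gaussianReal 0 1) :=
      (integrable_const _).add (memLp_id_gaussianReal 2).integrable_sq
    exact (hasFiniteIntegral_iff_ofReal (ae_of_all _ fun z => by positivity)).1 h1.2
  calc ∫⁻ x, ENNReal.ofReal (min 1 x) ∂(_root_.limitLevyMeasure relu ρ)
      ≤ ∫⁻ x, ENNReal.ofReal (min 1 x)
          ∂((ρ.prod (gaussianReal 0 1)).map (fun p : ℝ × ℝ => p.1 * relu p.2 ^ 2)) :=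
        lintegral_mono' Measure.restrict_le_self le_rfl
    _ = ∫⁻ w, ∫⁻ z, ENNReal.ofReal (min 1 (w * relu z ^ 2)) ∂(gaussianReal 0 1) ∂ρ := by
        rw [lintegral_map (by fun_prop) (by fun_prop), lintegral_prod _ (by fun_prop)]
    _ ≤ ∫⁻ w, ∫⁻ z, ENNReal.ofReal (min 1 w) * ENNReal.ofReal (1 + z ^ 2)
          ∂(gaussianReal 0 1) ∂ρ := by
        refine lintegral_mono_ae ?_
        filter_upwards [hρ.ae_pos] with w hw
        refine lintegral_mono fun z => ?_
        simp only
        rw [← ENNReal.ofReal_mul (le_min zero_le_one hw.le)]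
        refine ENNReal.ofReal_le_ofReal ?_
        have hz : relu z ^ 2 ≤ z ^ 2 := by
          unfold relu
          rcases le_total z 0 with h | h
          · rw [max_eq_right h]; simpa using sq_nonneg z
          · rw [max_eq_left h]
        have hz0 : 0 ≤ relu z ^ 2 := by positivity
        rcases le_total w 1 with h | h
        · rw [min_eq_right h]
          refine (min_le_right _ _).trans ?_
          gcongr
          linarith
        · rw [min_eq_left h]
          refine (min_le_left _ _).trans ?_
          linarith
    _ = (∫⁻ w, ENNReal.ofReal (min 1 w) ∂ρ) * ∫⁻ z, ENNReal.ofReal (1 + z ^ 2)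
          ∂(gaussianReal 0 1) := by
        rw [← lintegral_mul_const _ (by fun_prop)]
        refine lintegral_congr fun w => ?_
        rw [lintegral_const_mul _ (by fun_prop)]
    _ < ⊤ := ENNReal.mul_lt_top hρ.lintegral_min_lt_top hfin

/-! ### Regular variation and power bounds. -/

/-- `F` is regularly varying at infinity with index `-α`. -/
structure IsRegVar (F : ℝ → ℝ) (α : ℝ) : Prop where
  eventually_pos : ∀ᶠ u in atTop, 0 < F u
  tendsto_ratio : ∀ γ : ℝ, 0 < γ → Tendsto (fun u => F (γ * u) / F u) atTop (𝓝 (γ ^ (-α)))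

/-- `F` is antitone with values in `[0, 1]`. -/
structure IsTailFunction (F : ℝ → ℝ) : Prop where
  antitone : Antitone F
  nonneg : ∀ u, 0 ≤ F u
  le_one : ∀ u, F u ≤ 1

theorem isRegVar_rpow (α : ℝ) : IsRegVar (fun u => u ^ (-α)) α := by
  refine ⟨?_, fun γ hγ => ?_⟩
  · filter_upwards [eventually_gt_atTop 0] with u hu using by positivity
  · refine tendsto_const_nhds.congr' ?_
    filter_upwards [eventually_gt_atTop 0] with u hu
    have : u ^ (-α) ≠ 0 := by positivity
    rw [Real.mul_rpow hγ.le hu.le]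
    field_simp

theorem IsRegVar.of_tendsto_div {F G : ℝ → ℝ} {α κ : ℝ} (hF : IsRegVar F α) (hκ : 0 < κ)
    (h : Tendsto (fun u => G u / F u) atTop (𝓝 κ)) : IsRegVar G α := by
  refine ⟨?_, fun γ hγ => ?_⟩
  · filter_upwards [hF.eventually_pos, h.eventually_const_lt hκ] with u h1 h2
    exact (div_pos_iff_of_pos_right h1).1 h2
  · have hγt : Tendsto (fun u : ℝ => γ * u) atTop atTop := tendsto_id.const_mul_atTop hγ
    have h1 := ((h.comp hγt).mul (hF.tendsto_ratio γ hγ)).div h hκ.ne'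
    rw [mul_div_cancel_left₀ _ hκ.ne'] at h1
    refine h1.congr' ?_
    filter_upwards [hF.eventually_pos, hγt.eventually hF.eventually_pos] with u h2 h3
    simp only [Function.comp, Pi.div_apply]
    field_simp

theorem isRegVar_of_tendsto_rpow_mul {F : ℝ → ℝ} {τ κ : ℝ} (hκ : 0 < κ)
    (h : Tendsto (fun u => u ^ τ * F u) atTop (𝓝 κ)) : IsRegVar F τ := by
  refine (isRegVar_rpow τ).of_tendsto_div hκ (h.congr' ?_)
  filter_upwards [eventually_gt_atTop 0] with u hu
  rw [Real.rpow_neg hu.le, div_inv_eq_mul, mul_comm]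

theorem IsTailFunction.pos {F : ℝ → ℝ} {α : ℝ} (hT : IsTailFunction F) (hF : IsRegVar F α)
    (u : ℝ) : 0 < F u := by
  obtain ⟨v, hv, huv⟩ := (hF.eventually_pos.and (eventually_ge_atTop u)).exists
  exact hv.trans_le (hT.antitone huv)

theorem IsRegVar.tendsto_half {F : ℝ → ℝ} {α : ℝ} (hF : IsRegVar F α) :
    Tendsto (fun u => F (u / 2) / F u) atTop (𝓝 (2 ^ α)) := by
  have h := hF.tendsto_ratio (1 / 2) (by norm_num)
  rw [one_div, Real.inv_rpow (by norm_num), Real.rpow_neg (by norm_num), inv_inv] at h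
  refine h.congr fun u => ?_
  rw [inv_mul_eq_div]

theorem two_rpow_mul_half_rpow {u : ℝ} (hu : 0 < u) (s : ℝ) : (u / 2) ^ s * 2 ^ s = u ^ s := by
  rw [← Real.mul_rpow (by positivity) (by norm_num)]
  congr 1
  ring

/-- A Potter bound. -/
theorem IsRegVar.exists_potter {F : ℝ → ℝ} {α s : ℝ} (hT : IsTailFunction F) (hF : IsRegVar F α)
    (hs0 : 0 < s) (hs : α < s) :
    ∃ C u₀, 0 < C ∧ 0 < u₀ ∧ ∀ u, u₀ ≤ u → ∀ v, 0 < v → v ≤ u →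
      v ^ s * F v ≤ C * (u ^ s * F u) := by
  have h1 := hF.tendsto_half.eventually_le_const (u := 2 ^ s)
    (Real.rpow_lt_rpow_of_exponent_lt one_lt_two hs)
  obtain ⟨u₀, hu₀⟩ := eventually_atTop.1 (h1.and (eventually_gt_atTop 0))
  have hpos : 0 < u₀ := (hu₀ u₀ le_rfl).2
  have hF0 := hT.pos hF u₀
  have hhalf : ∀ u, u₀ ≤ u → F (u / 2) ≤ 2 ^ s * F u := fun u hu =>
    (div_le_iff₀ (hT.pos hF u)).1 (hu₀ u hu).1
  -- Chosen so that u₀^s = C (u₀ / 2)^s F(u₀), which settles u in [u₀ / 2, u₀].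
  set C := 2 ^ s / F u₀
  have hC : 0 < C := by positivity
  have hC2 : 2 ^ s ≤ C := le_div_self (by positivity) hF0 (hT.le_one _)
  -- The floor u₀ / 2 is where halving some u > u₀ can land; for v in (u / 2, u], monotonicity and
  -- F(u / 2) ≤ 2^s F(u) suffice.
  have key : ∀ u, 0 < u → u₀ / 2 ≤ u → ∀ v, 0 < v → v ≤ u →
      v ^ s * F v ≤ C * (u ^ s * F u) := by
    refine halving_induction hpos (fun u hu hle hge v hv hvu => ?_) fun u hu ih _ v hv hvu => ?_
    · calc v ^ s * F v ≤ u₀ ^ s * 1 := by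
            have := hT.le_one v
            have := hT.nonneg v
            have := hvu.trans hle
            gcongr
        _ = C * ((u₀ / 2) ^ s * F u₀) := by
            rw [← two_rpow_mul_half_rpow hpos]
            simp only [C]
            field_simp
        _ ≤ C * (u ^ s * F u) := by
            have := hT.antitone hle
            gcongr
    · have hu' : 0 < u := hpos.trans hu
      have h2 := hhalf u hu.le
      rcases le_or_gt v (u / 2) with h | h
      · calc v ^ s * F v ≤ C * ((u / 2) ^ s * F (u / 2)) := ih (by linarith) v hv h
          _ ≤ C * ((u / 2) ^ s * (2 ^ s * F u)) := by gcongr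
          _ = C * (u ^ s * F u) := by rw [← mul_assoc ((u / 2) ^ s), two_rpow_mul_half_rpow hu']
      · have h3 := hT.nonneg u
        have h4 := hT.nonneg v
        calc v ^ s * F v ≤ u ^ s * (2 ^ s * F u) := by
              have := (hT.antitone h.le).trans h2
              gcongr
          _ = 2 ^ s * (u ^ s * F u) := by ring
          _ ≤ C * (u ^ s * F u) := by gcongr
  exact ⟨C, u₀, hC, hpos, fun u hu => key u (hpos.trans_le hu) (by linarith)⟩

/-- For s < α eventually F(u / 2) ≥ 2^s F(u), so halving u can only increase u^s F(u). -/
theorem IsRegVar.exists_rpow_mul_le {F : ℝ → ℝ} {α s : ℝ} (hT : IsTailFunction F)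
    (hF : IsRegVar F α) (hs0 : 0 < s) (hs : s < α) : ∃ C, ∀ u, 0 < u → u ^ s * F u ≤ C := by
  have h1 := hF.tendsto_half.eventually_const_le (u := 2 ^ s)
    (Real.rpow_lt_rpow_of_exponent_lt one_lt_two hs)
  obtain ⟨u₀, hu₀⟩ := eventually_atTop.1 (h1.and (eventually_gt_atTop 0))
  have hpos : 0 < u₀ := (hu₀ u₀ le_rfl).2
  refine ⟨u₀ ^ s, halving_induction hpos (fun u hu hle => ?_) fun u hu ih => ?_⟩
  · calc u ^ s * F u ≤ u₀ ^ s * 1 := by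
          have := hT.le_one u
          have := hT.nonneg u
          gcongr
      _ = u₀ ^ s := mul_one _
  · refine le_trans ?_ ih
    have hu' : 0 < u := hpos.trans hu
    rw [← two_rpow_mul_half_rpow hu', mul_assoc]
    gcongr
    exact (le_div_iff₀ (hT.pos hF u)).1 (hu₀ u hu.le).1

/-- For α < s < t < β, G is O(u^{-t}), while the Potter bound at v = u₀ keeps F above a multiple of
u^{-s}. -/
theorem IsRegVar.tendsto_div_of_lt {F G : ℝ → ℝ} {α β : ℝ} (hTF : IsTailFunction F)
    (hTG : IsTailFunction G) (hF : IsRegVar F α) (hG : IsRegVar G β) (hα : 0 < α) (hαβ : α < β)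
    {M : ℝ} (hM : 0 < M) : Tendsto (fun u => G (u / M) / F u) atTop (𝓝 0) := by
  obtain ⟨s, hs1, hs⟩ := exists_between hαβ
  obtain ⟨t, hst, ht⟩ := exists_between hs
  have hs0 : 0 < s := hα.trans hs1
  obtain ⟨C, u₀, hC, hu₀, hpot⟩ := hF.exists_potter hTF hs0 hs1
  obtain ⟨D, hD⟩ := hG.exists_rpow_mul_le hTG (hs0.trans hst) ht
  have hc : 0 < u₀ ^ s * F u₀ := mul_pos (by positivity) (hTF.pos hF _)
  set c := u₀ ^ s * F u₀
  have hlim : Tendsto (fun u : ℝ => (M ^ t * D * C / c) * u ^ (-(t - s))) atTop (𝓝 0) := by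
    simpa using (tendsto_rpow_neg_atTop (sub_pos.2 hst)).const_mul (M ^ t * D * C / c)
  refine squeeze_zero' (Eventually.of_forall fun u => div_nonneg (hTG.nonneg _) (hTF.nonneg _)) ?_
    hlim
  filter_upwards [eventually_ge_atTop u₀] with u hu
  have hu0 : 0 < u := hu₀.trans_le hu
  have h1 := hpot u hu u₀ hu₀ hu
  have h2 := hD (u / M) (by positivity)
  have hFu := hTF.pos hF u
  have hGu := hTG.nonneg (u / M)
  have hD0 : 0 ≤ D := le_trans (by positivity) h2
  rw [Real.div_rpow hu0.le hM.le, div_mul_eq_mul_div, div_le_iff₀ (by positivity)] at h2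
  rw [div_le_iff₀ hFu, neg_sub, Real.rpow_sub hu0]
  have hus : 0 < u ^ s := by positivity
  have hut : 0 < u ^ t := by positivity
  have hMt : 0 < M ^ t := by positivity
  calc G (u / M) ≤ D * M ^ t / u ^ t := by rw [le_div_iff₀ hut]; linarith
    _ = D * M ^ t / u ^ t * 1 := (mul_one _).symm
    _ ≤ D * M ^ t / u ^ t * (C * (u ^ s * F u) / c) := by
        gcongr
        rwa [one_le_div hc]
    _ = _ := by field_simp

theorem IsRegVar.comp_div {F : ℝ → ℝ} {α s : ℝ} (hF : IsRegVar F α) (hs : 0 < s) :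
    IsRegVar (fun u => F (u / s)) α := by
  have ht : Tendsto (fun u : ℝ => u / s) atTop atTop := tendsto_id.atTop_div_const hs
  refine ⟨ht.eventually hF.eventually_pos, fun γ hγ => ?_⟩
  simpa only [Function.comp_def, mul_div_assoc] using (hF.tendsto_ratio γ hγ).comp ht

/-- Once u ≥ b / δ, F(u - b) lies between F(u) and F((1 - δ)u); then δ tends to 0. -/
theorem IsRegVar.comp_sub {F : ℝ → ℝ} {α b : ℝ} (hT : IsTailFunction F) (hF : IsRegVar F α)
    (hb : 0 ≤ b) : IsRegVar (fun u => F (u - b)) α := by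
  refine hF.of_tendsto_div one_pos (tendsto_order.2 ⟨fun c hc => ?_, fun c hc => ?_⟩)
  · refine Eventually.of_forall fun u => hc.trans_le ?_
    rw [one_le_div (hT.pos hF u)]
    exact hT.antitone (by linarith)
  · obtain ⟨δ, hδc, hδ, hδ1⟩ : ∃ δ : ℝ, (1 - δ) ^ (-α) < c ∧ 0 < δ ∧ δ < 1 := by
      have hcont : ContinuousAt (fun δ : ℝ => (1 - δ) ^ (-α)) 0 :=
        ContinuousAt.rpow_const (by fun_prop) (Or.inl (by simp))
      have h1 := (hcont.tendsto.mono_left (nhdsWithin_le_nhds (s := Set.Ioi 0))).eventually_lt_const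
        (u := c) (by simpa using hc)
      obtain ⟨δ, h2, h3⟩ := (h1.and (Ioo_mem_nhdsGT (zero_lt_one' ℝ))).exists
      exact ⟨δ, h2, h3.1, h3.2⟩
    filter_upwards [(hF.tendsto_ratio (1 - δ) (by linarith)).eventually_lt_const hδc,
      eventually_ge_atTop (b / δ)] with u h1 h2
    refine lt_of_le_of_lt ?_ h1
    have h3 := hT.pos hF u
    rw [div_le_iff₀ hδ] at h2
    gcongr
    exact hT.antitone (by linarith)

/-! ### Tails of products of independent variables. -/

/-- The survival function `u ↦ P(X > u)`. -/
noncomputable def survival {Ω : Type*} [MeasurableSpace Ω] (P : Measure Ω) (X : Ω → ℝ) (u : ℝ) :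
    ℝ := P.real {ω | u < X ω}

theorem real_lt_mul_eq {Ω : Type*} [MeasurableSpace Ω] {P : Measure Ω} {X : Ω → ℝ}
    (u : ℝ) {y : ℝ} (hy : 0 < y) :
    P.real {ω | u < X ω * y} = survival P X (u / y) := by
  unfold survival
  congr 1
  ext ω
  simp only [Set.mem_ofPred_eq]
  rw [div_lt_iff₀ hy]

theorem real_lt_mul_zero {Ω : Type*} [MeasurableSpace Ω] {P : Measure Ω} {X : Ω → ℝ}
    {u : ℝ} (hu : 0 ≤ u) : P.real {ω | u < X ω * 0} = 0 := by
  simp [not_lt.2 hu]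

section Survival

variable {Ω : Type*} [MeasurableSpace Ω] {P : Measure Ω} [IsProbabilityMeasure P] {X Y : Ω → ℝ}

theorem isTailFunction_survival (P : Measure Ω) [IsProbabilityMeasure P] (X : Ω → ℝ) :
    IsTailFunction (survival P X) :=
  ⟨fun _ _ huv => measureReal_mono fun _ hω => lt_of_le_of_lt huv hω,
    fun _ => measureReal_nonneg, fun _ => measureReal_le_one⟩

theorem measurable_survival_div (hX : Measurable X) (u : ℝ) :
    Measurable fun y => P.real {ω | u < X ω * y} := by
  have h : MeasurableSet {p : ℝ × Ω | u < X p.2 * p.1} :=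
    measurableSet_lt measurable_const (by fun_prop)
  exact (measurable_measure_prodMk_left (ν := P) h).ennreal_toReal

theorem integrable_survival_div (hX : Measurable X) (u : ℝ) (μ : Measure ℝ) [IsFiniteMeasure μ] :
    Integrable (fun y => P.real {ω | u < X ω * y}) μ := by
  refine (integrable_const (1 : ℝ)).mono' (measurable_survival_div hX u).aestronglyMeasurable ?_
  refine ae_of_all _ fun y => ?_
  rw [Real.norm_of_nonneg measureReal_nonneg]
  exact measureReal_le_one

theorem survival_mul (hX : Measurable X) (hY : Measurable Y) (h : IndepFun X Y P) (u : ℝ) :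
    survival P (fun ω => X ω * Y ω) u = ∫ y, P.real {ω | u < X ω * y} ∂(P.map Y) := by
  have hpX := Measure.isProbabilityMeasure_map hX.aemeasurable (μ := P)
  have hpY := Measure.isProbabilityMeasure_map hY.aemeasurable (μ := P)
  have hS : MeasurableSet {p : ℝ × ℝ | u < p.1 * p.2} :=
    measurableSet_lt measurable_const (by fun_prop)
  have h1 : P {ω | u < X ω * Y ω} = (P.map fun ω => (X ω, Y ω)) {p | u < p.1 * p.2} := by
    rw [Measure.map_apply (by fun_prop) hS]
    rfl
  rw [survival, measureReal_def, h1,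
    (indepFun_iff_map_prod_eq_prod_map_map hX.aemeasurable hY.aemeasurable).1 h,
    Measure.prod_apply_symm hS, ← integral_toReal (measurable_measure_prodMk_right hS).aemeasurable
      (ae_of_all _ fun y => measure_lt_top _ _)]
  refine integral_congr_ae (ae_of_all _ fun y => ?_)
  simp only
  rw [Measure.map_apply hX (measurable_prodMk_right hS)]
  rfl

theorem survival_mul_ge (h : IndepFun X Y P) {u k : ℝ} (hk : 0 < k) (hu : 0 < u) :
    survival P X (u / k) * survival P Y k ≤ survival P (fun ω => X ω * Y ω) u := by
  have h1 := h.measure_inter_preimage_eq_mul (Set.Ioi (u / k)) (Set.Ioi k) measurableSet_Ioi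
    measurableSet_Ioi
  have h2 : survival P X (u / k) * survival P Y k =
      P.real (X ⁻¹' Set.Ioi (u / k) ∩ Y ⁻¹' Set.Ioi k) := by
    rw [measureReal_def, h1, ENNReal.toReal_mul]
    rfl
  rw [h2]
  refine measureReal_mono fun ω hω => ?_
  have h3 : u / k < X ω := hω.1
  have h4 : k < Y ω := hω.2
  change u < X ω * Y ω
  rw [div_lt_iff₀ hk] at h3
  have : 0 < X ω := by
    by_contra hneg
    nlinarith
  nlinarith

/-- **Breiman's lemma.** -/
theorem tendsto_survival_mul_div (hX : Measurable X) (hY : Measurable Y) (h : IndepFun X Y P)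
    (hY0 : ∀ᵐ ω ∂P, 0 ≤ Y ω) {α s : ℝ} (hα : 0 < α) (hs : α < s)
    (hF : IsRegVar (survival P X) α) (hYs : Integrable (fun ω => Y ω ^ s) P) :
    Tendsto (fun u => survival P (fun ω => X ω * Y ω) u / survival P X u) atTop
      (𝓝 (∫ ω, Y ω ^ α ∂P)) := by
  have hpY := Measure.isProbabilityMeasure_map hY.aemeasurable (μ := P)
  have hT := isTailFunction_survival P X
  obtain ⟨C, u₀, hC, hu₀, hpot⟩ := hF.exists_potter hT (hα.trans hs) hs
  have hmap : ∫ ω, Y ω ^ α ∂P = ∫ y, y ^ α ∂(P.map Y) := by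
    rw [integral_map hY.aemeasurable (Measurable.aestronglyMeasurable (by fun_prop))]
  have hYs' : Integrable (fun y => y ^ s) (P.map Y) := by
    rw [integrable_map_measure (Measurable.aestronglyMeasurable (by fun_prop)) hY.aemeasurable]
    exact hYs
  have hY0' : ∀ᵐ y ∂(P.map Y), 0 ≤ y :=
    (ae_map_iff hY.aemeasurable measurableSet_Ici).2 hY0
  rw [hmap]
  simp_rw [survival_mul hX hY h, ← integral_div]
  -- Monotonicity bounds the ratio by 1 for y ≤ 1; the Potter bound gives C y^s for y > 1.
  refine tendsto_integral_filter_of_dominated_convergence (fun y => 1 + C * y ^ s) ?_ ?_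
    ((integrable_const _).add (hYs'.const_mul _)) ?_
  · exact Eventually.of_forall fun u =>
      ((measurable_survival_div hX u).div_const _).aestronglyMeasurable
  · filter_upwards [eventually_ge_atTop u₀] with u hu
    have hu0 : 0 < u := hu₀.trans_le hu
    filter_upwards [hY0'] with y hy
    rw [Real.norm_of_nonneg (div_nonneg measureReal_nonneg (hT.nonneg u))]
    have hFu := hT.pos hF u
    rcases hy.eq_or_lt with rfl | hy
    · rw [real_lt_mul_zero hu0.le, zero_div]
      have : (0 : ℝ) ≤ 0 ^ s := Real.rpow_nonneg le_rfl _
      positivity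
    · rw [real_lt_mul_eq u hy, div_le_iff₀ hFu]
      have hys : 0 < y ^ s := by positivity
      rcases le_total y 1 with h1 | h1
      · have h2 := hT.antitone (le_div_self hu0.le hy h1)
        nlinarith [mul_pos (mul_pos hC hys) hFu]
      · have h2 := hpot u hu (u / y) (by positivity) (div_le_self hu0.le h1)
        rw [Real.div_rpow hu0.le hy.le] at h2
        have hus : 0 < u ^ s := by positivity
        have h3 : survival P X (u / y) ≤ C * y ^ s * survival P X u := by
          have h4 : u ^ s / y ^ s * survival P X (u / y) =
            u ^ s * (survival P X (u / y) / y ^ s) := by ring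
          rw [h4, mul_left_comm] at h2
          have h5 := le_of_mul_le_mul_left h2 hus
          rw [div_le_iff₀ hys] at h5
          linarith
        linarith
  · filter_upwards [hY0'] with y hy
    rcases hy.eq_or_lt with rfl | hy
    · rw [Real.zero_rpow hα.ne']
      refine tendsto_const_nhds.congr' ?_
      filter_upwards [eventually_ge_atTop 0] with u hu
      rw [real_lt_mul_zero hu, zero_div]
    · have h1 := hF.tendsto_ratio (1 / y) (by positivity)
      rw [one_div, Real.inv_rpow hy.le, Real.rpow_neg hy.le, inv_inv] at h1
      refine h1.congr fun u => ?_
      rw [real_lt_mul_eq u hy, inv_mul_eq_div]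

/-- Products `XY` in which the tail of `Y` is negligible inherit the regular variation of `X`. -/
theorem IsRegVar.survival_mul (hX : Measurable X) (hY : Measurable Y) (h : IndepFun X Y P)
    (hY0 : ∀ᵐ ω ∂P, 0 ≤ Y ω) {α : ℝ} (hF : IsRegVar (survival P X) α)
    (hpos : ∀ᶠ u in atTop, 0 < survival P (fun ω => X ω * Y ω) u)
    (hsmall : ∀ M : ℝ, 0 < M → Tendsto
      (fun u => survival P Y (u / M) / survival P (fun ω => X ω * Y ω) u) atTop (𝓝 0)) :
    IsRegVar (survival P fun ω => X ω * Y ω) α := by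
  have hpY := Measure.isProbabilityMeasure_map hY.aemeasurable (μ := P)
  have hT := isTailFunction_survival P X
  have hY0' : ∀ᵐ y ∂(P.map Y), 0 ≤ y :=
    (ae_map_iff hY.aemeasurable measurableSet_Ici).2 hY0
  refine ⟨hpos, fun γ hγ => ?_⟩
  rw [Metric.tendsto_nhds]
  intro e he
  have he4 : 0 < e / 4 := by positivity
  have hγα : 0 < γ ^ (-α) := by positivity
  -- Conditioning on Y = y: if y ≤ u / M then u / y ≥ M, and X already obeys its scaling law up to
  -- e/4. The values y > u / M cost at most (1 + γ^(-α)) P(Y > u / M), negligible by assumption.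
  obtain ⟨M, hM⟩ := eventually_atTop.1
    ((Metric.tendsto_nhds.1 (hF.tendsto_ratio γ hγ) (e / 4) he4).and (eventually_gt_atTop 0))
  have hM0 : 0 < M := (hM M le_rfl).2
  have hM1 : ∀ x, M ≤ x → |survival P X (γ * x) - γ ^ (-α) * survival P X x| ≤
      e / 4 * survival P X x := fun x hx => by
    have h1 := (hM x hx).1
    have h2 := hT.pos hF x
    rw [Real.dist_eq] at h1
    have h3 : survival P X (γ * x) - γ ^ (-α) * survival P X x =
        (survival P X (γ * x) / survival P X x - γ ^ (-α)) * survival P X x := by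
      field_simp
    rw [h3, abs_mul, abs_of_pos h2]
    gcongr
  have hsm := (hsmall M hM0).const_mul (1 + γ ^ (-α))
  rw [mul_zero] at hsm
  filter_upwards [hpos, eventually_gt_atTop 0, hsm.eventually_le_const he4] with u hH hu hYu
  have key : |survival P (fun ω => X ω * Y ω) (γ * u) -
      γ ^ (-α) * survival P (fun ω => X ω * Y ω) u| ≤
      e / 4 * survival P (fun ω => X ω * Y ω) u + (1 + γ ^ (-α)) * survival P Y (u / M) := by
    have hSY : survival P Y (u / M) = ∫ y, (Set.Ioi (u / M)).indicator 1 y ∂(P.map Y) := by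
      rw [integral_indicator_one measurableSet_Ioi, map_measureReal_apply hY measurableSet_Ioi]
      rfl
    have hI : Integrable (fun y => (1 + γ ^ (-α)) * (Set.Ioi (u / M)).indicator (1 : ℝ → ℝ) y)
        (P.map Y) := ((integrable_const (1 : ℝ)).indicator measurableSet_Ioi).const_mul _
    rw [_root_.survival_mul hX hY h, _root_.survival_mul hX hY h, hSY, ← integral_const_mul,
      ← integral_const_mul, ← integral_const_mul,
      ← integral_sub (integrable_survival_div hX _ _) ((integrable_survival_div hX _ _).const_mul _),
      ← integral_add ((integrable_survival_div hX _ _).const_mul _) hI, ← Real.norm_eq_abs]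
    refine norm_integral_le_of_norm_le
      (((integrable_survival_div (P := P) hX u (P.map Y)).const_mul (e / 4)).add hI) ?_
    filter_upwards [hY0'] with y hy
    rw [Real.norm_eq_abs]
    rcases hy.eq_or_lt with rfl | hy
    · rw [real_lt_mul_zero hu.le, real_lt_mul_zero (by positivity)]
      have : (0 : ℝ) ≤ (Set.Ioi (u / M)).indicator 1 (0 : ℝ) :=
        Set.indicator_nonneg (fun _ _ => zero_le_one) _
      simp only [mul_zero, sub_zero, abs_zero, zero_add]
      positivity
    · rw [real_lt_mul_eq _ hy, real_lt_mul_eq _ hy]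
      rcases le_or_gt y (u / M) with hyM | hyM
      · rw [Set.indicator_of_notMem (by simpa using hyM), mul_zero, add_zero, mul_div_assoc]
        refine hM1 _ ?_
        rw [le_div_iff₀ hM0] at hyM
        rw [le_div_iff₀ hy]
        linarith
      · rw [Set.indicator_of_mem (by simpa using hyM)]
        have h1 := hT.nonneg (γ * u / y)
        have h2 := hT.nonneg (u / y)
        have h3 := hT.le_one (γ * u / y)
        have h4 := hT.le_one (u / y)
        simp only [Pi.one_apply, mul_one]
        have h5 : γ ^ (-α) * survival P X (u / y) ≤ γ ^ (-α) := by nlinarith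
        have h6 : 0 ≤ γ ^ (-α) * survival P X (u / y) := by positivity
        have h7 : 0 ≤ e / 4 * survival P X (u / y) := by positivity
        rw [abs_le]
        constructor <;> linarith
  set H := survival P (fun ω => X ω * Y ω)
  have h1 : H (γ * u) / H u - γ ^ (-α) = (H (γ * u) - γ ^ (-α) * H u) / H u := by field_simp
  rw [Real.dist_eq, h1, abs_div, abs_of_pos hH, div_lt_iff₀ hH]
  rw [← mul_div_assoc, div_le_iff₀ hH] at hYu
  nlinarith [mul_pos he hH]

/-- P(XY > u) ≥ P(X > u) P(Y > 1), and a heavier tail of X makes P(Y > u / M) negligible against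
this. -/
theorem IsRegVar.survival_mul_of_lt (hX : Measurable X) (hY : Measurable Y) (h : IndepFun X Y P)
    (hY0 : ∀ᵐ ω ∂P, 0 ≤ Y ω) {α β : ℝ} (hα : 0 < α) (hαβ : α < β)
    (hF : IsRegVar (survival P X) α) (hG : IsRegVar (survival P Y) β) :
    IsRegVar (survival P fun ω => X ω * Y ω) α := by
  have hTX := isTailFunction_survival P X
  have hTY := isTailFunction_survival P Y
  have h1 : ∀ u, 0 < u → survival P X u * survival P Y 1 ≤ survival P (fun ω => X ω * Y ω) u :=
    fun u hu => by simpa using survival_mul_ge h one_pos hu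
  have hY1 := hTY.pos hG 1
  refine hF.survival_mul hX hY h hY0 ?_ fun M hM => ?_
  · filter_upwards [eventually_gt_atTop 0] with u hu
    exact (mul_pos (hTX.pos hF u) hY1).trans_le (h1 u hu)
  · have h2 := (hF.tendsto_div_of_lt hTX hTY hG hα hαβ hM).div_const (survival P Y 1)
    rw [zero_div] at h2
    refine squeeze_zero' (Eventually.of_forall fun u => div_nonneg (hTY.nonneg _)
      measureReal_nonneg) ?_ h2
    filter_upwards [eventually_gt_atTop 0] with u hu
    rw [div_div]
    exact div_le_div_of_nonneg_left (hTY.nonneg _) (mul_pos (hTX.pos hF u) hY1) (h1 u hu)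

/-- The dyadic layers 2^j < X ≤ 2^(j+1) are disjoint, and on each one Y > u / 2^j forces XY > u. -/
theorem sum_le_survival_mul (hX : Measurable X) (hY : Measurable Y) (h : IndepFun X Y P) (J : ℕ)
    {u : ℝ} (hu : 0 < u) :
    ∑ j ∈ Finset.range J, (survival P X (2 ^ j) - survival P X (2 ^ (j + 1))) *
      survival P Y (u / 2 ^ j) ≤ survival P (fun ω => X ω * Y ω) u := by
  set A : ℕ → Set Ω := fun j => X ⁻¹' Set.Ioc (2 ^ j) (2 ^ (j + 1))
  set E : ℕ → Set Ω := fun j => A j ∩ Y ⁻¹' Set.Ioi (u / 2 ^ j)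
  have hA : ∀ j, P.real (A j) = survival P X (2 ^ j) - survival P X (2 ^ (j + 1)) := fun j => by
    have hsub : {ω | 2 ^ (j + 1) < X ω} ⊆ {ω | 2 ^ j < X ω} :=
      fun ω (hω : 2 ^ (j + 1) < X ω) => show 2 ^ j < X ω from
        lt_of_le_of_lt (pow_le_pow_right₀ one_le_two (Nat.le_succ j)) hω
    have hm : MeasurableSet {ω | 2 ^ (j + 1) < X ω} := hX measurableSet_Ioi
    rw [survival, survival, ← measureReal_sdiff hsub hm]
    congr 1
    ext ω
    simp [A]
  have hE : ∀ j, P.real (E j) = (survival P X (2 ^ j) - survival P X (2 ^ (j + 1))) *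
      survival P Y (u / 2 ^ j) := fun j => by
    rw [← hA, measureReal_def, h.measure_inter_preimage_eq_mul _ _ measurableSet_Ioc
      measurableSet_Ioi, ENNReal.toReal_mul]
    rfl
  have hdisj : Set.PairwiseDisjoint (↑(Finset.range J)) E := by
    intro i _ j _ hij
    refine Disjoint.mono Set.inter_subset_left Set.inter_subset_left ?_
    refine Disjoint.preimage X ?_
    exact (pow_right_mono₀ (one_le_two (α := ℝ))).pairwise_disjoint_on_Ioc_succ hij
  have hmeas : ∀ j ∈ Finset.range J, MeasurableSet (E j) := fun j _ =>
    (hX measurableSet_Ioc).inter (hY measurableSet_Ioi)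
  rw [← Finset.sum_congr rfl fun j _ => hE j, ← measureReal_biUnion_finset hdisj hmeas]
  refine measureReal_mono fun ω hω => ?_
  obtain ⟨j, -, ⟨hj1, -⟩, hj2⟩ : ∃ j ∈ Finset.range J, ω ∈ E j := by simpa using hω
  have h2 : u / 2 ^ j < Y ω := hj2
  have h3 : (2 : ℝ) ^ j < X ω := hj1
  have h4 : (0 : ℝ) < 2 ^ j := by positivity
  change u < X ω * Y ω
  rw [div_lt_iff₀ h4] at h2
  have : 0 < Y ω := by
    by_contra hneg
    nlinarith
  nlinarith

/-- The exact power tail of X makes its α-th moment infinite, so XY has a strictly heavier tail than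
Y even though the indices agree. -/
theorem IsRegVar.survival_mul_of_eq (hX : Measurable X) (hY : Measurable Y) (h : IndepFun X Y P)
    (hY0 : ∀ᵐ ω ∂P, 0 ≤ Y ω) {α c : ℝ} (hα : 0 < α) (hc : 0 < c)
    (hF : Tendsto (fun u => u ^ α * survival P X u) atTop (𝓝 c))
    (hG : IsRegVar (survival P Y) α) :
    IsRegVar (survival P fun ω => X ω * Y ω) α := by
  have hFR := isRegVar_of_tendsto_rpow_mul hc hF
  have hTX := isTailFunction_survival P X
  have hTY := isTailFunction_survival P Y
  set H := survival P fun ω => X ω * Y ω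
  set d : ℕ → ℝ := fun j => (survival P X (2 ^ j) - survival P X (2 ^ (j + 1))) * (2 ^ j) ^ α
  have hd0 : ∀ j, 0 ≤ d j := fun j => by
    have := hTX.antitone (pow_le_pow_right₀ (one_le_two (α := ℝ)) (Nat.le_succ j))
    have : 0 ≤ survival P X (2 ^ j) - survival P X (2 ^ (j + 1)) := sub_nonneg.2 this
    positivity
  -- The dyadic pieces of the α-th moment tend to c(1 - 2^(-α)) > 0, so their sum diverges.
  have hdlim : Tendsto d atTop (𝓝 (c - 2 ^ (-α) * c)) := by
    have hp : Tendsto (fun j : ℕ => (2 : ℝ) ^ j) atTop atTop :=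
      tendsto_pow_atTop_atTop_of_one_lt one_lt_two
    refine ((hF.comp hp).sub ((hF.comp (hp.comp (tendsto_add_atTop_nat 1))).const_mul
      (2 ^ (-α)))).congr fun j => ?_
    simp only [Function.comp, d]
    rw [pow_succ, Real.mul_rpow (by positivity) (by norm_num), Real.rpow_neg (by norm_num)]
    have : (2 : ℝ) ^ α ≠ 0 := by positivity
    field_simp
  have hlt : (2 : ℝ) ^ (-α) < 1 := Real.rpow_lt_one_of_one_lt_of_neg one_lt_two (by linarith)
  have hdiv : Tendsto (fun J => ∑ j ∈ Finset.range J, d j) atTop atTop := by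
    rw [← not_summable_iff_tendsto_nat_atTop_of_nonneg hd0]
    intro hsum
    have h1 := tendsto_nhds_unique hdlim hsum.tendsto_atTop_zero
    nlinarith
  -- With J layers fixed, regular variation of Y makes the lower bound divided by P(Y > u) converge
  -- to the J-th partial sum of d, which can exceed any R.
  have hinf : Tendsto (fun u => H u / survival P Y u) atTop atTop := by
    rw [tendsto_atTop]
    intro R
    obtain ⟨J, hJ⟩ := (hdiv.eventually_gt_atTop R).exists
    have h1 : Tendsto (fun u => ∑ j ∈ Finset.range J,
        (survival P X (2 ^ j) - survival P X (2 ^ (j + 1))) *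
          (survival P Y ((2 ^ j)⁻¹ * u) / survival P Y u)) atTop
        (𝓝 (∑ j ∈ Finset.range J, d j)) := by
      refine tendsto_finsetSum _ fun j _ => Tendsto.const_mul _ ?_
      have h2 := hG.tendsto_ratio (2 ^ j)⁻¹ (by positivity)
      rwa [Real.inv_rpow (by positivity), Real.rpow_neg (by positivity), inv_inv] at h2
    filter_upwards [h1.eventually_const_lt hJ, eventually_gt_atTop 0] with u h2 hu
    refine h2.le.trans ?_
    rw [le_div_iff₀ (hTY.pos hG u), Finset.sum_mul]
    refine le_trans (le_of_eq (Finset.sum_congr rfl fun j _ => ?_))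
      (sum_le_survival_mul hX hY h J hu)
    have := (hTY.pos hG u).ne'
    rw [inv_mul_eq_div]
    field_simp
  refine hFR.survival_mul hX hY h hY0 ?_ fun M hM => ?_
  · filter_upwards [hinf.eventually_gt_atTop 0] with u hu
    exact (div_pos_iff_of_pos_right (hTY.pos hG u)).1 hu
  · have h1 := (hG.tendsto_ratio M⁻¹ (by positivity)).mul hinf.inv_tendsto_atTop
    rw [mul_zero] at h1
    refine h1.congr fun u => ?_
    have := (hTY.pos hG u).ne'
    simp only [Pi.inv_apply]
    rw [inv_div, inv_mul_eq_div, div_mul_div_cancel₀ this]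

/-- The exact power tail of X matters only for equal indices; Y, later a variance, need only vary
regularly. -/
theorem IsRegVar.survival_mul_min (hX : Measurable X) (hY : Measurable Y) (h : IndepFun X Y P)
    (hX0 : ∀ᵐ ω ∂P, 0 ≤ X ω) (hY0 : ∀ᵐ ω ∂P, 0 ≤ Y ω) {α β c : ℝ} (hα : 0 < α) (hβ : 0 < β)
    (hc : 0 < c) (hF : Tendsto (fun u => u ^ α * survival P X u) atTop (𝓝 c))
    (hG : IsRegVar (survival P Y) β) :
    IsRegVar (survival P fun ω => X ω * Y ω) (min α β) := by
  have hFR := isRegVar_of_tendsto_rpow_mul hc hF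
  rcases lt_trichotomy α β with hlt | rfl | hlt
  · rw [min_eq_left hlt.le]
    exact hFR.survival_mul_of_lt hX hY h hY0 hα hlt hG
  · rw [min_self]
    exact hG.survival_mul_of_eq hX hY h hY0 hα hc hF
  · rw [min_eq_right hlt.le]
    simp_rw [mul_comm (X _)]
    exact hG.survival_mul_of_lt hY hX h.symm hX0 hβ hlt hFR

end Survival

/-! ### Tail constants of S^(l) and the variance recursion. -/

theorem asympAtTop_of_tendsto_rpow_mul {f g : ℝ → ℝ} {τ κ : ℝ} (hκ : κ ≠ 0)
    (hf : Tendsto (fun u => u ^ τ * f u) atTop (𝓝 κ))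
    (hg : Tendsto (fun u => u ^ τ * g u) atTop (𝓝 κ)) : AsympAtTop f g := by
  have h := hf.div hg hκ
  rw [div_self hκ] at h
  refine h.congr' ?_
  filter_upwards [eventually_gt_atTop 0] with u hu
  have : u ^ τ ≠ 0 := by positivity
  exact mul_div_mul_left _ _ this

theorem tendsto_rpow_mul_const_mul_rpow_neg (τ κ : ℝ) :
    Tendsto (fun u : ℝ => u ^ τ * (κ * u ^ (-τ))) atTop (𝓝 κ) := by
  refine tendsto_const_nhds.congr' ?_
  filter_upwards [eventually_gt_atTop 0] with u hu
  rw [Real.rpow_neg hu.le]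
  have : u ^ τ ≠ 0 := by positivity
  field_simp

theorem limitShift_nonneg (φ : ℝ → ℝ) {a : ℝ} (ha : 0 ≤ a) : 0 ≤ limitShift φ a :=
  mul_nonneg ha (integral_nonneg fun z => sq_nonneg (φ z))

theorem tendsto_rpow_mul_survival {Ω : Type*} [MeasurableSpace Ω] {P : Measure Ω} {X : Ω → ℝ}
    (hX : Measurable X) {a : ℝ} (ha : 0 ≤ a) {ρ : Measure ℝ} (hρ : IsLevyMeasure ρ) {c τ : ℝ}
    (hc : 0 < c) (hτ : 0 < τ) (htail : AsympAtTop (levyTail ρ) fun x => c * x ^ (-τ))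
    (hlaw : IsInfDivLaw (P.map X) (limitShift relu a) (limitLevyMeasure relu ρ)) :
    Tendsto (fun u => u ^ τ * survival P X u) atTop (𝓝 (c * (chiSqMoment τ / 2))) := by
  refine (hlaw.tendsto_tail hρ.limitLevyMeasure (limitShift_nonneg _ ha) hτ
    (hρ.tendsto_limitLevyMeasure hτ (htail.tendsto_rpow_mul hc.ne'))).congr fun u => ?_
  rw [map_measureReal_apply hX measurableSet_Ioi]
  rfl

theorem minExponent_one (τ : ℕ → ℝ) : minExponent τ 1 le_rfl = τ 1 := by
  simp [minExponent]

theorem minExponent_succ (τ : ℕ → ℝ) {m : ℕ} (hm : 1 ≤ m) (hm' : 1 ≤ m + 1) :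
    minExponent τ (m + 1) hm' = min (τ (m + 1)) (minExponent τ m hm) := by
  have h : Finset.Icc 1 (m + 1) = insert (m + 1) (Finset.Icc 1 m) := by
    ext i
    simp only [Finset.mem_Icc, Finset.mem_insert]
    omega
  simp only [minExponent, h]
  rw [Finset.inf'_insert (Finset.nonempty_Icc.2 hm)]

theorem minExponent_pos {τ : ℕ → ℝ} {m : ℕ} (hm : 1 ≤ m)
    (hτ : ∀ l, 1 ≤ l → l ≤ m → 0 < τ l) : 0 < minExponent τ m hm :=
  (Finset.lt_inf'_iff _).2 fun l hl => hτ l (Finset.mem_Icc.1 hl).1 (Finset.mem_Icc.1 hl).2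

section LimitVariance

variable {Ω Ω' : Type*} {d : ℕ} {σb σv : ℝ} {x : EuclideanSpace ℝ (Fin d)}

/-- The two sample spaces may differ, so that Σ^(m) can be rewritten as a function of the tuple
(S^(1), …, S^(m-1)). -/
theorem limitVariance_congr {S : ℕ → Ω → ℝ} {S' : ℕ → Ω' → ℝ} {ω : Ω} {ω' : Ω'} (m : ℕ)
    (h : ∀ l, 1 ≤ l → l < m → S l ω = S' l ω') :
    limitVariance σb σv x S m ω = limitVariance σb σv x S' m ω' := by
  induction m with
  | zero => rfl
  | succ n ih =>
    cases n with
    | zero => rfl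
    | succ n =>
      simp only [limitVariance]
      rw [ih fun l h1 h2 => h l h1 (by omega), h (n + 1) (by omega) (by omega)]

theorem measurable_limitVariance [MeasurableSpace Ω] {S : ℕ → Ω → ℝ} (m : ℕ)
    (h : ∀ l, 1 ≤ l → l < m → Measurable (S l)) :
    Measurable (limitVariance σb σv x S m) := by
  induction m with
  | zero => exact measurable_const
  | succ n ih =>
    cases n with
    | zero => exact measurable_const
    | succ n =>
      exact measurable_const.add (((h (n + 1) (by omega) (by omega)).const_mul _).mul
        (ih fun l h1 h2 => h l h1 (by omega)))

theorem limitVariance_nonneg [MeasurableSpace Ω] {P : Measure Ω} {S : ℕ → Ω → ℝ} (m : ℕ)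
    (h : ∀ l, 1 ≤ l → l < m → ∀ᵐ ω ∂P, 0 ≤ S l ω) :
    ∀ᵐ ω ∂P, 0 ≤ limitVariance σb σv x S m ω := by
  induction m with
  | zero => exact ae_of_all _ fun _ => le_rfl
  | succ n ih =>
    cases n with
    | zero =>
      refine ae_of_all _ fun _ => ?_
      simp only [limitVariance]
      positivity
    | succ n =>
      filter_upwards [ih fun l h1 h2 => h l h1 (by omega), h (n + 1) (by omega) (by omega)]
        with ω h1 h2
      simp only [limitVariance]
      positivity

theorem indepFun_limitVariance [MeasurableSpace Ω] {P : Measure Ω} {S : ℕ → Ω → ℝ} {L m : ℕ}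
    (hm : 1 ≤ m) (hmL : m ≤ L) (hS : ∀ l, 1 ≤ l → l ≤ L → Measurable (S l))
    (h : iIndepFun (fun l : Finset.Icc 1 L => S l) P) :
    IndepFun (S m) (limitVariance σb σv x S m) P := by
  have hmem : ∀ {l}, 1 ≤ l → l < m → l ∈ Finset.Icc 1 L := fun h1 h2 =>
    Finset.mem_Icc.2 ⟨h1, by omega⟩
  let i₀ : Finset.Icc 1 L := ⟨m, Finset.mem_Icc.2 ⟨hm, hmL⟩⟩
  let T : Finset (Finset.Icc 1 L) := Finset.univ.filter fun l => l.1 < m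
  have hT : ∀ {l} (h1 : 1 ≤ l) (h2 : l < m), (⟨l, hmem h1 h2⟩ : Finset.Icc 1 L) ∈ T :=
    fun h1 h2 => by simpa [T] using h2
  have hdisj : Disjoint {i₀} T := by
    rw [Finset.disjoint_singleton_left]
    simp [T, i₀]
  have hind := h.indepFun_finset {i₀} T hdisj fun l =>
    hS l (Finset.mem_Icc.1 l.2).1 (Finset.mem_Icc.1 l.2).2
  -- Coordinate functions on tuples indexed by the layers below m; the value 0 elsewhere never
  -- enters Σ^(m).
  let S' : ℕ → (T → ℝ) → ℝ := fun l f =>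
    if hl : 1 ≤ l ∧ l < m then f ⟨⟨l, hmem hl.1 hl.2⟩, hT hl.1 hl.2⟩ else 0
  have hS' : ∀ l, Measurable (S' l) := fun l => by
    by_cases hl : 1 ≤ l ∧ l < m
    · simp only [S', hl, and_self, dite_true]
      exact measurable_pi_apply _
    · simp only [S', hl, dite_false]
      exact measurable_const
  have hφ : Measurable fun f : ({i₀} : Finset (Finset.Icc 1 L)) → ℝ =>
      f ⟨i₀, Finset.mem_singleton_self _⟩ := measurable_pi_apply _
  have hcomp := hind.comp (ψ := limitVariance σb σv x S' m) hφ
    (measurable_limitVariance m fun l _ _ => hS' l)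
  have hV : limitVariance σb σv x S m = limitVariance σb σv x S' m ∘ fun ω (i : T) => S i ω := by
    funext ω
    refine limitVariance_congr m fun l h1 h2 => ?_
    simp [S', h1, h2]
  rw [hV]
  exact hcomp

end LimitVariance

theorem survival_const_add_mul {Ω : Type*} [MeasurableSpace Ω] {P : Measure Ω} {W : Ω → ℝ} {b s : ℝ}
    (hs : 0 < s) (u : ℝ) :
    survival P (fun ω => b + s * W ω) u = survival P W ((u - b) / s) := by
  unfold survival
  congr 1
  ext ω
  simp only [Set.mem_ofPred_eq]
  rw [div_lt_iff₀ hs, sub_lt_iff_lt_add', mul_comm]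

theorem IsRegVar.survival_const_add_mul {Ω : Type*} [MeasurableSpace Ω] {P : Measure Ω}
    [IsProbabilityMeasure P] {W : Ω → ℝ} {α b s : ℝ} (hW : IsRegVar (survival P W) α)
    (hb : 0 ≤ b) (hs : 0 < s) : IsRegVar (survival P fun ω => b + s * W ω) α := by
  have hT := isTailFunction_survival P W
  have hT' : IsTailFunction fun u => survival P W (u / s) :=
    ⟨fun u v huv => hT.antitone (by gcongr), fun _ => hT.nonneg _, fun _ => hT.le_one _⟩
  have := (hW.comp_div hs).comp_sub hT' hb
  simpa only [← _root_.survival_const_add_mul hs] using this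

/-- The limiting conditional variances are regularly varying. -/
theorem isRegVar_survival_limitVariance {Ω : Type*} [MeasurableSpace Ω] {P : Measure Ω}
    [IsProbabilityMeasure P] {L d : ℕ} (hd : 1 ≤ d) {σb σv : ℝ} (hσv : 0 < σv)
    {x : EuclideanSpace ℝ (Fin d)} (hx : σb ≠ 0 ∨ x ≠ 0) {S : ℕ → Ω → ℝ} {τ κ : ℕ → ℝ}
    (hτ : ∀ l, 1 ≤ l → l ≤ L → 0 < τ l) (hκ : ∀ l, 1 ≤ l → l ≤ L → 0 < κ l)
    (hS : ∀ l, 1 ≤ l → l ≤ L → Measurable (S l))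
    (hS0 : ∀ l, 1 ≤ l → l ≤ L → ∀ᵐ ω ∂P, 0 ≤ S l ω)
    (hind : iIndepFun (fun l : Finset.Icc 1 L => S l) P)
    (htail : ∀ l, 1 ≤ l → l ≤ L →
      Tendsto (fun u => u ^ τ l * survival P (S l) u) atTop (𝓝 (κ l)))
    (m : ℕ) (hm : 1 ≤ m) (hmL : m ≤ L) :
    IsRegVar (survival P (limitVariance σb σv x S (m + 1))) (minExponent τ m hm) := by
  have hσ : 0 < σv ^ 2 := by positivity
  have hstep : ∀ {α : ℝ} (n : ℕ),
      IsRegVar (survival P fun ω => S (n + 1) ω * limitVariance σb σv x S (n + 1) ω) α →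
      IsRegVar (survival P (limitVariance σb σv x S (n + 1 + 1))) α := fun {α} n h => by
    have := h.survival_const_add_mul (sq_nonneg σb) hσ
    simp only [← mul_assoc] at this
    exact this
  induction m, hm using Nat.le_induction with
  | base =>
    refine hstep 0 ?_
    rw [minExponent_one]
    -- Σ^(1) is deterministic; if it were 0, the first product would lose the tail of S^(1).
    have hK : 0 < σb ^ 2 + σv ^ 2 * ‖x‖ ^ 2 / d := by
      have hd' : (0 : ℝ) < d := by exact_mod_cast hd
      rcases hx with h | h
      · have : 0 < σb ^ 2 := by positivity
        positivity
      · have : 0 < ‖x‖ := norm_pos_iff.2 h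
        positivity
    have := (isRegVar_of_tendsto_rpow_mul (hκ 1 le_rfl hmL)
      (htail 1 le_rfl hmL)).survival_const_add_mul le_rfl hK
    simp only [zero_add, mul_comm _ (S 1 _)] at this
    exact this
  | succ m hm ih =>
    refine hstep m ?_
    rw [minExponent_succ τ hm]
    have hm1 : 1 ≤ m + 1 := Nat.le_add_left 1 m
    exact IsRegVar.survival_mul_min (hS _ hm1 hmL)
      (measurable_limitVariance _ fun l h1 h2 => hS l h1 (by omega))
      (indepFun_limitVariance hm1 hmL hS hind) (hS0 _ hm1 hmL)
      (limitVariance_nonneg _ fun l h1 h2 => hS0 l h1 (by omega)) (hτ _ hm1 hmL)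
      (minExponent_pos hm fun l h1 h2 => hτ l h1 (by omega)) (hκ _ hm1 hmL) (htail _ hm1 hmL)
      (ih (by omega))

/-! ### Slow variation, Gaussian mixtures and the conclusion. -/

theorem IsRegVar.isSlowlyVarying {F : ℝ → ℝ} {α : ℝ} (hT : IsTailFunction F) (hF : IsRegVar F α) :
    IsSlowlyVarying fun u => u ^ α * F u := by
  refine ⟨Measurable.mul (by fun_prop) hT.antitone.measurable, ?_, fun γ hγ => ?_⟩
  · filter_upwards [eventually_gt_atTop 0] with u hu
    have := hT.pos hF u
    positivity
  · have h := (hF.tendsto_ratio γ hγ).const_mul (γ ^ α)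
    rw [← Real.rpow_add hγ, add_neg_cancel, Real.rpow_zero] at h
    refine h.congr' ?_
    filter_upwards [eventually_gt_atTop 0] with u hu
    have := hT.pos hF u
    have : 0 < u ^ α := by positivity
    rw [Real.mul_rpow hγ.le hu.le]
    field_simp

/-- The tail of a squared centred Gaussian mixture with regularly varying variance. -/
theorem tendsto_survival_gaussian_mixture_div {Ω : Type*} [MeasurableSpace Ω] {P : Measure Ω}
    [IsProbabilityMeasure P] {V e : Ω → ℝ} (hV : Measurable V) (hV0 : ∀ᵐ ω ∂P, 0 ≤ V ω)
    (he : HasLaw e (gaussianReal 0 1) P) (hind : IndepFun e V P) {α : ℝ} (hα : 0 < α)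
    (hF : IsRegVar (survival P V) α) :
    Tendsto (fun u => survival P (fun ω => (e ω * √(V ω)) ^ 2) u / survival P V u) atTop
      (𝓝 (chiSqMoment α)) := by
  -- `HasLaw` gives only a.e. measurability, so ε² is replaced by a measurable version.
  set Y : Ω → ℝ := fun ω => he.aemeasurable.mk e ω ^ 2
  have hae : e =ᵐ[P] he.aemeasurable.mk e := he.aemeasurable.ae_eq_mk
  have hY : Measurable Y := he.aemeasurable.measurable_mk.pow_const 2
  have hVY : IndepFun V Y P :=
    (hind.congr hae (ae_eq_refl V)).symm.comp measurable_id (measurable_id.pow_const 2)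
  have hYe : ∀ s : ℝ, (fun ω => Y ω ^ s) =ᵐ[P] (fun z : ℝ => (z ^ 2) ^ s) ∘ e := fun s => by
    filter_upwards [hae] with ω hω
    simp [Y, ← hω]
  have hm : ∀ s : ℝ, AEStronglyMeasurable (fun z : ℝ => (z ^ 2) ^ s) (P.map e) := fun s =>
    Measurable.aestronglyMeasurable (by fun_prop)
  have hYs : Integrable (fun ω => Y ω ^ (α + 1)) P := by
    refine Integrable.congr ?_ (hYe (α + 1)).symm
    rw [← integrable_map_measure (hm _) he.aemeasurable, he.map_eq]
    exact integrable_sq_rpow_gaussianReal (by linarith)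
  have hint : ∫ ω, Y ω ^ α ∂P = chiSqMoment α := by
    rw [integral_congr_ae (hYe α), ← integral_sq_rpow_gaussianReal hα, ← he.map_eq,
      integral_map he.aemeasurable (hm _)]
    rfl
  have h := tendsto_survival_mul_div hV hY hVY (ae_of_all _ fun ω => sq_nonneg _) hα
    (lt_add_one α) hF hYs
  rw [hint] at h
  refine h.congr fun u => ?_
  congr 1
  refine measureReal_congr ?_
  filter_upwards [hae, hV0] with ω h1 h2
  have : V ω * Y ω = (e ω * √(V ω)) ^ 2 := by
    simp only [Y]
    rw [mul_pow, Real.sq_sqrt h2, ← h1, mul_comm]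
  change (u < V ω * Y ω) = (u < (e ω * √(V ω)) ^ 2)
  rw [this]

theorem mainTheorem7
    {Ω : Type*} [MeasurableSpace Ω] (P : Measure Ω) [IsProbabilityMeasure P]
    (L d : ℕ) (hL : 1 ≤ L) (hd : 1 ≤ d)
    (σb σv : ℝ) (hσb : 0 ≤ σb) (hσv : 0 < σv)
    -- the parameters of the infinitely divisible limits at the layers `1, …, L`
    (a : ℕ → ℝ) (ρ : ℕ → Measure ℝ)
    (ha : ∀ l, 1 ≤ l → l ≤ L → 0 ≤ a l)
    (hρ : ∀ l, 1 ≤ l → l ≤ L → IsLevyMeasure (ρ l))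
    -- power-law tails of the Lévy measures
    (c τ : ℕ → ℝ)
    (hc : ∀ l, 1 ≤ l → l ≤ L → 0 < c l)
    (hτ : ∀ l, 1 ≤ l → l ≤ L → 0 < τ l)
    (htail : ∀ l, 1 ≤ l → l ≤ L →
      AsympAtTop (levyTail (ρ l)) (fun x => c l * x ^ (-τ l)))
    -- the independent random variables `S^(1), …, S^(L)`
    (S : ℕ → Ω → ℝ)
    (hSmeas : ∀ l, 1 ≤ l → l ≤ L → Measurable (S l))
    (hSindep : iIndepFun (fun l : Finset.Icc 1 L => S l) P)
    (hSlaw : ∀ l, 1 ≤ l → l ≤ L →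
      IsInfDivLaw (P.map (S l)) (limitShift relu (a l)) (limitLevyMeasure relu (ρ l)))
    -- the input, and the standard normal variables `ε_k^(l)`, independent of `Σ^(l)(x)`
    (x : EuclideanSpace ℝ (Fin d))
    (ε : ℕ → ℕ → Ω → ℝ)
    (hεlaw : ∀ l k, 2 ≤ l → l ≤ L + 1 → 1 ≤ k → HasLaw (ε l k) (gaussianReal 0 1) P)
    (hεindep : ∀ l k, 2 ≤ l → l ≤ L + 1 → 1 ≤ k →
      IndepFun (ε l k) (limitVariance σb σv x S l) P) :
    (∀ l, 1 ≤ l → l ≤ L →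
      AsympAtTop (fun u => P.real {ω | u < S l ω}) (fun u => nuTail (ρ l) u / 2) ∧
      AsympAtTop (fun u => nuTail (ρ l) u / 2)
        (fun u => (c l * 2 ^ (τ l - 1) * Real.Gamma (τ l + 1 / 2) / √Real.pi) *
          u ^ (-τ l))) ∧
    -- `m` is `l - 1` for the layers `l = 2, …, L + 1`
    ((σb ≠ 0 ∨ x ≠ 0) → ∀ m, ∀ hm : 1 ≤ m, m ≤ L →
      ∃ ℓ : ℝ → ℝ, IsSlowlyVarying ℓ ∧
        AsympAtTop (fun u => P.real {ω | u < limitVariance σb σv x S (m + 1) ω})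
          (fun u => u ^ (-minExponent τ m hm) * ℓ u) ∧
        ∀ k, 1 ≤ k →
          AsympAtTop
            (fun u => P.real
              {ω | u < (ε (m + 1) k ω * √(limitVariance σb σv x S (m + 1) ω)) ^ 2})
            (fun u => u ^ (-minExponent τ m hm) * ℓ u *
              (2 ^ minExponent τ m hm *
                (Real.Gamma (minExponent τ m hm + 1 / 2) / Real.Gamma (1 / 2))))) := by
  have hκ : ∀ l, 1 ≤ l → l ≤ L → 0 < c l * (chiSqMoment (τ l) / 2) := fun l h1 h2 =>
    mul_pos (hc l h1 h2) (half_pos (chiSqMoment_pos (hτ l h1 h2)))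
  have hStail : ∀ l, 1 ≤ l → l ≤ L → Tendsto (fun u => u ^ τ l * survival P (S l) u) atTop
      (𝓝 (c l * (chiSqMoment (τ l) / 2))) := fun l h1 h2 =>
    tendsto_rpow_mul_survival (hSmeas l h1 h2) (ha l h1 h2) (hρ l h1 h2) (hc l h1 h2)
      (hτ l h1 h2) (htail l h1 h2) (hSlaw l h1 h2)
  have hS0 : ∀ l, 1 ≤ l → l ≤ L → ∀ᵐ ω ∂P, 0 ≤ S l ω := fun l h1 h2 =>
    (ae_map_iff (hSmeas l h1 h2).aemeasurable measurableSet_Ici).1 (hSlaw l h1 h2).ae_nonneg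
  refine ⟨fun l h1 h2 => ?_, fun hx m hm hmL => ?_⟩
  · have hκl := hκ l h1 h2
    have hν : Tendsto (fun u => u ^ τ l * (nuTail (ρ l) u / 2)) atTop
        (𝓝 (c l * (chiSqMoment (τ l) / 2))) := by
      have := ((hρ l h1 h2).tendsto_nuTail (hτ l h1 h2)
        ((htail l h1 h2).tendsto_rpow_mul (hc l h1 h2).ne')).div_const 2
      simpa only [mul_div_assoc] using this
    refine ⟨asympAtTop_of_tendsto_rpow_mul hκl.ne' (hStail l h1 h2) hν,
      asympAtTop_of_tendsto_rpow_mul hκl.ne' hν ?_⟩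
    have hconst : c l * 2 ^ (τ l - 1) * Real.Gamma (τ l + 1 / 2) / √Real.pi =
        c l * (chiSqMoment (τ l) / 2) := by
      rw [chiSqMoment, Real.Gamma_one_half_eq, Real.rpow_sub_one two_ne_zero]
      ring
    rw [hconst]
    exact tendsto_rpow_mul_const_mul_rpow_neg _ _
  · have hT := isTailFunction_survival P (limitVariance σb σv x S (m + 1))
    have hV := isRegVar_survival_limitVariance hd hσv hx hτ hκ hSmeas hS0 hSindep hStail m hm hmL
    set β := minExponent τ m hm
    have hβ : 0 < β := minExponent_pos hm fun l h1 h2 => hτ l h1 (h2.trans hmL)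
    have hcancel : ∀ u : ℝ, 0 < u → u ^ (-β) *
        (u ^ β * survival P (limitVariance σb σv x S (m + 1)) u) =
          survival P (limitVariance σb σv x S (m + 1)) u := fun u hu => by
      rw [← mul_assoc, ← Real.rpow_add hu, neg_add_cancel, Real.rpow_zero, one_mul]
    -- The witness is u^β P(Σ > u), so u^(-β) times it is the tail itself for u > 0.
    refine ⟨_, hV.isSlowlyVarying hT, ?_, fun k hk => ?_⟩
    · refine tendsto_const_nhds.congr' ?_
      filter_upwards [eventually_gt_atTop 0] with u hu
      rw [hcancel u hu]
      exact (div_self (hT.pos hV u).ne').symm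
    · have hK := chiSqMoment_pos hβ
      have h := (tendsto_survival_gaussian_mixture_div
        (measurable_limitVariance _ fun l h1 h2 => hSmeas l h1 (by omega))
        (limitVariance_nonneg _ fun l h1 h2 => hS0 l h1 (by omega))
        (hεlaw (m + 1) k (by omega) (by omega) hk) (hεindep (m + 1) k (by omega) (by omega) hk)
        hβ hV).div_const (chiSqMoment β)
      rw [div_self hK.ne'] at h
      refine h.congr' ?_
      filter_upwards [eventually_gt_atTop 0] with u hu
      rw [hcancel u hu, div_div]
      rfl
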